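/- **Circuits.** An \emph{extended arithmetic circuit} with $n$ inputs, $\ell$ auxiliary memory gates and $m$ outputs is a finite simple directed acyclic graph of gates: $n$ ordered input gates and $\ell$ ordered auxiliary memory gates (indegree $0$; together the \emph{memory gates}), $m$ ordered output gates (indegree $1$, outdegree $0$, copying their predecessor), constant gates labelled by reals (indegree $0$), addition and multiplication gates of unbounded fan-in, and possibly gates labelled by a function $f\colon\mathbb R\to\mathbb R$ from a given set $\mathcal B$ (indegree and outdegree $1$). Gates are evaluated along the graph in the obvious way. The size is the number of gates; the depth is the maximal length of a directed path between any two gates. For $\ell=0$ we speak of an \emph{arithmetic circuit}, whose depth is the maximal length of a directed path from an input gate to an output gate. A family $(C_n)_{n\in\mathbb N}$, where $C_n$ has $n$ inputs, is an $\mathrm{FAC}^i_{\mathbb R}[\mathcal B]$-family if it uses only functions from $\mathcal B$ as additional gates, has size $O(n^{O(1)})$ and depth $O((\log n)^i)$; $\mathrm{FAC}^i_{\mathbb R}[\mathcal B]$ is also the class of functions $\mathbb R^*\to\mathbb R^*$ computed by such families of arithmetic circuits. For $\mathfrak F=\mathrm{FAC}^i_{\mathbb R}[\mathcal B]$ put $\mathfrak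 F[\mathcal A]=\mathrm{FAC}^i_{\mathbb R}[\mathcal B\cup\mathcal A]$ and $\mathfrak F_s=\mathfrak F[\{\mathrm{sign}\}]$, where $\mathrm{sign}(x)=1$ if $x>0$ and $0$ otherwise. **Recurrent circuits.** A \emph{recurrent arithmetic circuit} with $n$ inputs consists of an extended arithmetic circuit $C$ with $n$ inputs, initial values for its auxiliary memory gates, exactly one recurrent edge into each memory gate (from a gate that is not an output gate), an ordered set of $p$ distinct halting gates, and a halting function $f_{\mathrm{halt}}\colon\mathbb N_{>0}\times\mathbb R^p\to\{0,1\}$. In iterations $k=1,2,\dots$ the circuit $C$ is evaluated on the current values of the memory gates (at first the input and the initial values). If $f_{\mathrm{halt}}$, applied to $k$ and the values of the halting gates, is $1$, the result is the tuple of values of the output gates; otherwise each memory gate takes the value of the source of its recurrent edge and iteration $k+1$ follows. If this never stops, the computed function is undefined. A family $(\textit{rec-}C_n)_n$, where $\textit{rec-}C_n$ has $n$ inputs, computes a partial function $\mathbb R^*\rightharpoonup\mathbb R^*$. It belongs to $\mathrm{rec}[\mathfrak F_s]\text{-}\mathfrak F[\mathcal A]$ if the underlying extended circuits form an $\mathfrak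 F[\mathcal A]$-family and there is one $\mathfrak F_s$-family $(D_k)_k$ of arithmetic circuits such that, for every $n$, the halting function of $\textit{rec-}C_n$ is $(k,\overline v)\mapsto f_{D_{p+1}}(k,\overline v)$, where $p$ is the number of halting gates of $\textit{rec-}C_n$. **Networks.** A labelled graph $\mathfrak G=(V,E,g_V)$ is a finite simple undirected graph with ordered vertex set and feature values $g_V\colon V\to\mathbb R$; its encoding $\langle\mathfrak G\rangle\in\mathbb R^{|V|^2+|V|}$ is its adjacency matrix, row by row, followed by the feature values in the order of $V$. A function on $\mathbb R^*$ is tail-symmetric if it is invariant under permutations of all arguments but the first; $t\mathfrak F$ denotes the tail-symmetric functions in $\mathfrak F$. A $\mathrm{rec}[t\mathfrak F_s]\text{-}(t\mathfrak F,\mathcal A)$-GNN $\textit{rec-}\mathcal N$ (a C-GNN with outer recurrence) consists of a periodic assignment $k\mapsto(f^{(k)},\sigma^{(k)})$ of real-valued functions $f^{(k)}\in t\mathfrak F$ and activation functions $\sigma^{(k)}\in\mathcal A$, where $\mathcal A$ is a set of functions $\mathbb R\to\mathbb R$, and a tail-symmetric halting function $h\colon\mathbb N_{>0}\times\mathbb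 R^*\to\{0,1\}$ computed by an $\mathfrak F_s$-family of arithmetic circuits. On $\mathfrak G$ it computes $h_V^{(0)}=g_V$ and $$h_V^{(k)}(w)=\sigma^{(k)}\Bigl(f^{(k)}\bigl(h_V^{(k-1)}(w),\{\!\!\{h_V^{(k-1)}(u)\mid \{u,w\}\in E\}\!\!\}\bigr)\Bigr)\qquad(k\ge 1),$$ and $f_{\textit{rec-}\mathcal N}(\mathfrak G)=(V,E,h_V^{(\ell)})$ for the least $\ell\ge 1$ with $h(\ell,\{\!\!\{h_V^{(\ell)}(v)\mid v\in V\}\!\!\})=1$; it is undefined if there is no such $\ell$. **Theorem.** Let $\mathfrak F=\mathrm{FAC}^i_{\mathbb R}[\mathcal B]$ with $i\in\mathbb N$ and $\mathcal B$ a set of functions $\mathbb R\to\mathbb R$, let $\mathcal A$ be a set of functions $\mathbb R\to\mathbb R$, and let $\textit{rec-}\mathcal N$ be a $\mathrm{rec}[t\mathfrak F_s]\text{-}(t\mathfrak F,\mathcal A)$-GNN. Then there is a partial function $f_{\mathrm{circ}}\in\mathrm{rec}[\mathfrak F_s]\text{-}\mathfrak F[\mathcal A]$ such that for all labelled graphs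 $\mathfrak G$ $$f_{\mathrm{circ}}(\langle\mathfrak G\rangle)=\langle f_{\textit{rec-}\mathcal N}(\mathfrak G)\rangle,$$ where the left side is defined if and only if the right side is. (Thus the underlying circuits need no sign gates beyond those that $\mathcal B\cup\mathcal A$ may already provide.) -/

import Mathlib

open Filter Asymptotics

noncomputable section

/-! ## Arithmetic circuits over the reals -/

/-- Gates of a circuit with `n` input gates, `l` auxiliary memory gates, `m` output gates and
a further set `I` of inner gates. -/
inductive Gate (n l m : ℕ) (I : Type) : Type
  | inp (j : Fin n)
  | aux (j : Fin l)
  | out (j : Fin m)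
  | inner (g : I)

/-- The gates as a disjoint union. -/
def Gate.equivSum (n l m : ℕ) (I : Type) :
    Gate n l m I ≃ (Fin n ⊕ Fin l) ⊕ (Fin m ⊕ I) where
  toFun
    | .inp j => .inl (.inl j)
    | .aux j => .inl (.inr j)
    | .out j => .inr (.inl j)
    | .inner g => .inr (.inr g)
  invFun
    | .inl (.inl j) => .inp j
    | .inl (.inr j) => .aux j
    | .inr (.inl j) => .out j
    | .inr (.inr g) => .inner g
  left_inv g := by cases g <;> rfl
  right_inv g := by rcases g with (g | g) | (g | g) <;> rfl

instance (n l m : ℕ) (I : Type) [Fintype I] : Fintype (Gate n l m I) :=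
  Fintype.ofEquiv _ (Gate.equivSum n l m I).symm

/-- Labels of the inner gates: a real constant, addition, multiplication, or a unary function
`f : ℝ → ℝ` used as an additional gate type. -/
inductive GateOp : Type
  | const (c : ℝ)
  | add
  | mul
  | fn (f : ℝ → ℝ)

/-- An extended arithmetic circuit with `n` inputs, `l` auxiliary memory gates and `m` outputs:
a finite simple directed acyclic graph, given by the finite set of predecessors of each gate.
Addition and multiplication gates have unbounded fan-in. -/
structure ExtCircuit (n l m : ℕ) where
  Inner : Type
  fintypeInner : Fintype Inner
  op : Inner → GateOp
  pred : Gate n l m Inner → Finset (Gate n l m Inner)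
  acyclic : ∀ g, ¬ Relation.TransGen (fun a b => a ∈ pred b) g g
  pred_inp : ∀ j, pred (.inp j) = ∅
  pred_aux : ∀ j, pred (.aux j) = ∅
  pred_out : ∀ j, (pred (.out j)).card = 1
  out_notMem_pred : ∀ j g, Gate.out j ∉ pred g
  pred_const : ∀ g c, op g = .const c → pred (.inner g) = ∅
  pred_fn : ∀ g f, op g = .fn f → (pred (.inner g)).card = 1
  succ_fn : ∀ g f, op g = .fn f → ∃! h, Gate.inner g ∈ pred h

namespace ExtCircuit

variable {n l m : ℕ} (C : ExtCircuit n l m)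

instance : Fintype C.Inner := C.fintypeInner

/-- The gates of the circuit. -/
abbrev Gates : Type := Gate n l m C.Inner

/-- `C.Edge g h`: there is an edge from `g` to `h`. -/
def Edge (g h : C.Gates) : Prop := g ∈ C.pred h

theorem wellFounded_edge : WellFounded C.Edge := by
  have hT : WellFounded (Relation.TransGen C.Edge) := by
    have : Std.Irrefl (Relation.TransGen C.Edge) := ⟨C.acyclic⟩
    exact Finite.wellFounded_of_trans_of_irrefl _
  exact Subrelation.wf (fun h => Relation.TransGen.single h) hT

/-- The value that a gate takes on input `x` and auxiliary memory values `a`.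
Output gates and function gates have exactly one predecessor, so the sums in these two cases
are the value of that predecessor. -/
def val (x : Fin n → ℝ) (a : Fin l → ℝ) : C.Gates → ℝ :=
  C.wellFounded_edge.fix fun g rec =>
    match g, rec with
    | .inp j, _ => x j
    | .aux j, _ => a j
    | .out j, rec => ∑ p : {p // p ∈ C.pred (.out j)}, rec p.1 p.2
    | .inner g, rec =>
      match C.op g with
      | .const c => c
      | .add => ∑ p : {p // p ∈ C.pred (.inner g)}, rec p.1 p.2
      | .mul => ∏ p : {p // p ∈ C.pred (.inner g)}, rec p.1 p.2
      | .fn f => f (∑ p : {p // p ∈ C.pred (.inner g)}, rec p.1 p.2)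

/-- The function `ℝⁿ × ℝˡ → ℝᵐ` computed by the circuit. -/
def eval (x : Fin n → ℝ) (a : Fin l → ℝ) : Fin m → ℝ := fun j => C.val x a (.out j)

/-- The number of gates. -/
def size : ℕ := Fintype.card C.Gates

/-- `C.Path g h k`: there is a directed path of length `k` from `g` to `h`. -/
inductive Path : C.Gates → C.Gates → ℕ → Prop
  | nil (g : C.Gates) : Path g g 0
  | snoc {g h h' : C.Gates} {k : ℕ} : Path g h k → C.Edge h h' → Path g h' (k + 1)

/-- Depth of an extended circuit: the maximal length of a directed path between any two gates. -/
def depth : ℕ := sSup {k | ∃ g h, C.Path g h k}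

/-- Depth of a non-extended circuit: the maximal length of a directed path from an input gate to
an output gate. -/
def ioDepth : ℕ := sSup {k | ∃ i j, C.Path (.inp i) (.out j) k}

/-- All function gates of the circuit are labelled with functions from `B`. -/
def UsesOnly (B : Set (ℝ → ℝ)) : Prop := ∀ g f, C.op g = .fn f → f ∈ B

end ExtCircuit

/-- A (non-extended) arithmetic circuit: no auxiliary memory gates. -/
abbrev ArithCircuit (n m : ℕ) : Type 1 := ExtCircuit n 0 m

/-! ## Circuit families and the classes `FAC^i[B]` -/

/-- `s(n) = O(n^{O(1)})`. -/
def PolyBounded (s : ℕ → ℕ) : Prop :=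
  ∃ k : ℕ, (fun n => (s n : ℝ)) =O[atTop] fun n : ℕ => (n : ℝ) ^ k

/-- `d(n) = O((log n)^i)`. -/
def PolylogBounded (i : ℕ) (d : ℕ → ℕ) : Prop :=
  (fun n => (d n : ℝ)) =O[atTop] fun n : ℕ => Real.log n ^ i

/-- A family of (non-extended) arithmetic circuits, one for each input length. -/
structure CircuitFamily where
  numOut : ℕ → ℕ
  circuit : ∀ n, ArithCircuit n (numOut n)

namespace CircuitFamily

/-- The function `ℝ* → ℝ*` computed by the family. -/
def eval (C : CircuitFamily) (x : List ℝ) : List ℝ :=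
  List.ofFn ((C.circuit x.length).eval x.get Fin.elim0)

/-- `C` is an `FAC^i[B]`-circuit family. -/
def IsFAC (C : CircuitFamily) (i : ℕ) (B : Set (ℝ → ℝ)) : Prop :=
  (∀ n, (C.circuit n).UsesOnly B) ∧
  PolyBounded (fun n => (C.circuit n).size) ∧
  PolylogBounded i (fun n => (C.circuit n).ioDepth)

end CircuitFamily

/-- The circuit function class `FAC^i[B]` of functions `ℝ* → ℝ*`. -/
def FAC (i : ℕ) (B : Set (ℝ → ℝ)) : Set (List ℝ → List ℝ) :=
  {f | ∃ C : CircuitFamily, C.IsFAC i B ∧ C.eval = f}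

/-- The sign function: `1` on positive reals, `0` otherwise. -/
def signFn (x : ℝ) : ℝ := if 0 < x then 1 else 0

/-- Bits as real numbers. -/
def bitR (b : Bool) : ℝ := if b then 1 else 0

/-! ## Recurrent arithmetic circuits -/

/-- A recurrent arithmetic circuit with `n` inputs. `recInp j` and `recAux j` are the sources of
the unique recurrent edges into the `j`-th input gate and the `j`-th auxiliary memory gate; as
output gates have fan-out zero, they are no output gates. The halting gates are an ordered set. -/
structure RecCircuit (n : ℕ) where
  numAux : ℕ
  numOut : ℕ
  circuit : ExtCircuit n numAux numOut
  init : Fin numAux → ℝ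
  recInp : Fin n → circuit.Gates
  recAux : Fin numAux → circuit.Gates
  recInp_ne_out : ∀ j k, recInp j ≠ .out k
  recAux_ne_out : ∀ j k, recAux j ≠ .out k
  numHalt : ℕ
  haltGate : Fin numHalt ↪ circuit.Gates
  halt : ℕ+ → (Fin numHalt → ℝ) → Bool

namespace RecCircuit

variable {n : ℕ} (R : RecCircuit n)

/-- Values of the input gates and of the auxiliary memory gates. -/
abbrev State : Type := (Fin n → ℝ) × (Fin R.numAux → ℝ)

/-- The memory gates take the values of the sources of their recurrent edges. -/
def step (s : R.State) : R.State :=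
  (fun j => R.circuit.val s.1 s.2 (R.recInp j), fun j => R.circuit.val s.1 s.2 (R.recAux j))

/-- Memory values during iteration `k + 1`. -/
def state (x : Fin n → ℝ) (k : ℕ) : R.State := R.step^[k] (x, R.init)

/-- The halting function evaluates to `1` in iteration `k + 1`. -/
def HaltsAt (x : Fin n → ℝ) (k : ℕ) : Prop :=
  R.halt k.succPNat
    (fun j => R.circuit.val (R.state x k).1 (R.state x k).2 (R.haltGate j)) = true

open Classical in
/-- The partial function computed by a recurrent circuit: the output of the first iteration in
which the halting function evaluates to `1`, undefined if there is none. -/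
def eval (x : Fin n → ℝ) : Part (Fin R.numOut → ℝ) where
  Dom := ∃ k, R.HaltsAt x k
  get h := R.circuit.eval (R.state x (Nat.find h)).1 (R.state x (Nat.find h)).2

end RecCircuit

/-- A recurrent arithmetic circuit family. -/
abbrev RecCircuitFamily : Type 1 := ∀ n, RecCircuit n

namespace RecCircuitFamily

/-- The partial function `ℝ* → ℝ*` computed by the family. -/
def eval (R : RecCircuitFamily) : List ℝ →. List ℝ := fun x =>
  ((R x.length).eval x.get).map List.ofFn

/-- The underlying extended circuits form an `FAC^i[B]`-family. -/
def UnderlyingFAC (R : RecCircuitFamily) (i : ℕ) (B : Set (ℝ → ℝ)) : Prop :=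
  (∀ n, (R n).circuit.UsesOnly B) ∧
  PolyBounded (fun n => (R n).circuit.size) ∧
  PolylogBounded i (fun n => (R n).circuit.depth)

/-- All halting functions belong to one `FAC^i[B]`-circuit family: the halting function of a
circuit with `p` halting gates is the function computed by the member with `p + 1` inputs, the
first of which is the iteration number. -/
def HaltingFAC (R : RecCircuitFamily) (i : ℕ) (B : Set (ℝ → ℝ)) : Prop :=
  ∃ D : CircuitFamily, D.IsFAC i B ∧ ∀ (n : ℕ) (k : ℕ+) (v : Fin (R n).numHalt → ℝ),
    D.eval (((k : ℕ) : ℝ) :: List.ofFn v) = [bitR ((R n).halt k v)]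

end RecCircuitFamily

/-- The recurrent circuit function class `rec[FAC^j[B']]-FAC^i[B]`. -/
def RecFAC (j : ℕ) (B' : Set (ℝ → ℝ)) (i : ℕ) (B : Set (ℝ → ℝ)) : Set (List ℝ →. List ℝ) :=
  {f | ∃ R : RecCircuitFamily, R.UnderlyingFAC i B ∧ R.HaltingFAC j B' ∧ R.eval = f}

/-! ## Labelled graphs -/

/-- A finite undirected graph with ordered vertex set and real feature values. -/
structure LabelledGraph where
  numV : ℕ
  graph : SimpleGraph (Fin numV)
  feature : Fin numV → ℝ

namespace LabelledGraph

open Classical in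
/-- The neighbours of `w`, listed in the order of the vertices. -/
def nbrs (G : LabelledGraph) (w : Fin G.numV) : List (Fin G.numV) :=
  (List.finRange G.numV).filter fun u => G.graph.Adj w u

open Classical in
/-- The adjacency matrix, row by row, followed by the feature values. -/
def encode (G : LabelledGraph) : List ℝ :=
  ((List.finRange G.numV).flatMap fun u =>
    (List.finRange G.numV).map fun v => G.graph.adjMatrix ℝ u v) ++ List.ofFn G.feature

end LabelledGraph

/-! ## Recurrent circuit graph neural networks -/

/-- `f(v₁, v₂, …, v_k)` is invariant under permutations of `v₂, …, v_k`, for every `k`. -/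
def TailSymmetric (f : List ℝ → ℝ) : Prop :=
  ∀ (x : ℝ) (l l' : List ℝ), l.Perm l' → f (x :: l) = f (x :: l')

/-- The real-valued tail-symmetric functions in `FAC^i[B]`. -/
def tFAC (i : ℕ) (B : Set (ℝ → ℝ)) : Set (List ℝ → ℝ) :=
  {f | TailSymmetric f ∧ (fun x => [f x]) ∈ FAC i B}

/-- The tail-symmetric halting functions `ℕ_{>0} × ℝ* → {0,1}` computed by
`FAC^i[B]`-circuit families. -/
def tFACHalt (i : ℕ) (B : Set (ℝ → ℝ)) : Set (ℕ+ → List ℝ → Bool) :=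
  {h | (∀ (k : ℕ+) (l l' : List ℝ), l.Perm l' → h k l = h k l') ∧
    ∃ D : CircuitFamily, D.IsFAC i B ∧ ∀ (k : ℕ+) (v : List ℝ),
      D.eval (((k : ℕ) : ℝ) :: v) = [bitR (h k v)]}

/-- A recurrent circuit graph neural network: layer functions, activation functions, and a
halting function. Layers are numbered from `1`. -/
structure RecCGNN where
  fn : ℕ → List ℝ → ℝ
  act : ℕ → ℝ → ℝ
  halt : ℕ+ → List ℝ → Bool

namespace RecCGNN

/-- `N` is a `rec[H]-(S, A)`-GNN: layers are assigned periodically, the layer functions are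
from `S`, the activation functions from `A`, and the halting function from `H`. -/
structure IsGNN (N : RecCGNN) (H : Set (ℕ+ → List ℝ → Bool)) (S : Set (List ℝ → ℝ))
    (A : Set (ℝ → ℝ)) : Prop where
  periodic : ∃ d : ℕ, 0 < d ∧ Function.Periodic (fun k => (N.fn k, N.act k)) d
  fn_mem : ∀ k, N.fn k ∈ S
  act_mem : ∀ k, N.act k ∈ A
  halt_mem : N.halt ∈ H

variable (N : RecCGNN) (G : LabelledGraph)

/-- The feature values after layer `k`. For tail-symmetric layer functions the order in which
the neighbours are listed is irrelevant. -/
def feat : ℕ → Fin G.numV → ℝ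
  | 0 => G.feature
  | k + 1 => fun w => N.act (k + 1) (N.fn (k + 1) (feat k w :: (G.nbrs w).map (feat k)))

/-- The halting function evaluates to `1` after layer `k + 1`. -/
def HaltsAt (k : ℕ) : Prop := N.halt k.succPNat (List.ofFn (N.feat G (k + 1))) = true

open Classical in
/-- The partial function on labelled graphs computed by the network: the feature values after the
first layer at which the halting function evaluates to `1`, undefined if there is none. -/
def eval : Part LabelledGraph where
  Dom := ∃ k, N.HaltsAt G k
  get h := { G with feature := N.feat G (Nat.find h + 1) }

end RecCGNN

end

/-!
The circuit keeps the encoding of the graph in its input gates and the number of the current layer,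
modulo the period, as a one-hot vector in its auxiliary memory. In each iteration it evaluates all
layers of a period and selects the right one by multiplication with the one-hot vector.

The neighbours of a vertex `w` are collected without sign gates: the number of neighbours of `w`
below `u` is a partial row sum of the adjacency matrix, hence a natural number less than `n`, and
equality of such numbers is decided by a Lagrange basis polynomial of degree less than `n`. So the
feature value of the `j`-th neighbour of `w` is a polynomial of bounded depth and polynomial size
in the encoding, and the degree of `w`, which determines the member of the circuit family to be
applied, can be tested in the same way.

The depth of a non-extended circuit takes only the paths from input to output gates into account,
whereas all paths count in a recurrent circuit. A gate that cannot be reached from an input gate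
has a constant value, and a gate from which no output gate can be reached is irrelevant. Once both
are replaced by constants, all paths are as short as those from input to output gates.
-/

theorem not_transGen_of_rank {α : Type*} {r : α → α → Prop} (rank : α → ℕ)
    (hrank : ∀ a b, r a b → rank a < rank b) (a : α) : ¬ Relation.TransGen r a a := fun h =>
  lt_irrefl (rank a) (by simpa only [Relation.transGen_eq_self] using h.lift rank hrank)

/-- A rank function for circuits without edges between inner gates. -/
def Gate.stage {n l m : ℕ} {I : Type} : Gate n l m I → ℕ
  | .out _ => 2
  | .inner _ => 1
  | _ => 0

theorem Gate.stage_le_two {n l m : ℕ} {I : Type} (g : Gate n l m I) : g.stage ≤ 2 := by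
  cases g <;> simp only [Gate.stage, le_refl, Nat.one_le_ofNat, Nat.zero_le]

/-- The value of a gate labelled `o` whose predecessors are the members of `s`, with values `v`. -/
def GateOp.apply {α : Type*} : GateOp → Finset α → (α → ℝ) → ℝ
  | .const c, _, _ => c
  | .add, s, v => ∑ p ∈ s, v p
  | .mul, s, v => ∏ p ∈ s, v p
  | .fn f, s, v => f (∑ p ∈ s, v p)

theorem GateOp.apply_congr {α : Type*} (o : GateOp) {s : Finset α} {v v' : α → ℝ}
    (h : ∀ p ∈ s, v p = v' p) : o.apply s v = o.apply s v' := by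
  cases o with
  | const c => rfl
  | add => exact Finset.sum_congr rfl h
  | mul => exact Finset.prod_congr rfl h
  | fn f => exact congrArg f (Finset.sum_congr rfl h)

theorem GateOp.apply_map {α β : Type*} (o : GateOp) (s : Finset α) (φ : α ↪ β) (v : β → ℝ) :
    o.apply (s.map φ) v = o.apply s (v ∘ φ) := by
  cases o <;> simp [GateOp.apply]

/-- The numbers of predecessors that a circuit may give to a gate labelled `o`. -/
def GateOp.HasFanIn : GateOp → ℕ → Prop
  | .const _, k => k = 0
  | .add, _ => True
  | .mul, _ => True
  | .fn _, k => k = 1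

namespace ExtCircuit

variable {n l m : ℕ}

section Values

variable (C : ExtCircuit n l m) (x : Fin n → ℝ) (a : Fin l → ℝ)

/-- The operation performed by a gate, `none` for memory gates. Output gates copy their only
predecessor, which is the same as adding it up. -/
def label : C.Gates → Option GateOp
  | .inp _ => none
  | .aux _ => none
  | .out _ => some .add
  | .inner g => some (C.op g)

theorem val_inp (j : Fin n) : C.val x a (.inp j) = x j :=
  C.wellFounded_edge.fix_eq _ _

theorem val_aux (j : Fin l) : C.val x a (.aux j) = a j :=
  C.wellFounded_edge.fix_eq _ _

theorem val_of_label {g : C.Gates} {o : GateOp} (h : C.label g = some o) :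
    C.val x a g = o.apply (C.pred g) (C.val x a) := by
  have hfix := C.wellFounded_edge.fix_eq (C := fun _ => ℝ)
  match g with
  | .out j =>
    cases h
    rw [GateOp.apply, ← Finset.sum_coe_sort]
    exact hfix _ _
  | .inner g =>
    cases h
    refine (hfix _ _).trans ?_
    change (match C.op g with
      | .const c => c
      | .add => ∑ p : {p // p ∈ C.pred (.inner g)}, C.val x a p
      | .mul => ∏ p : {p // p ∈ C.pred (.inner g)}, C.val x a p
      | .fn f => f (∑ p : {p // p ∈ C.pred (.inner g)}, C.val x a p)) = _
    rw [Finset.sum_coe_sort, Finset.prod_coe_sort]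
    cases C.op g <;> rfl

theorem val_out_of_pred_eq {j : Fin m} {g : C.Gates} (h : C.pred (.out j) = {g}) :
    C.val x a (.out j) = C.val x a g := by
  rw [C.val_of_label x a (g := .out j) rfl, h, GateOp.apply, Finset.sum_singleton]

variable {C} in
theorem val_map {n' l' m' : ℕ} {C' : ExtCircuit n' l' m'} (φ : C.Gates ↪ C'.Gates)
    {x' : Fin n' → ℝ} {a' : Fin l' → ℝ} (hinp : ∀ j, C'.val x' a' (φ (.inp j)) = x j)
    (haux : ∀ j, C'.val x' a' (φ (.aux j)) = a j)
    (hφ : ∀ g o, C.label g = some o →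
      C'.label (φ g) = some o ∧ C'.pred (φ g) = (C.pred g).map φ) (g : C.Gates) :
    C'.val x' a' (φ g) = C.val x a g := by
  induction g using C.wellFounded_edge.induction with
  | _ g ih =>
    rcases hg : C.label g with _ | o
    · cases g with
      | inp j => rw [hinp, val_inp]
      | aux j => rw [haux, val_aux]
      | out j => cases hg
      | inner g => cases hg
    · obtain ⟨hlabel, hpred⟩ := hφ g o hg
      rw [C'.val_of_label x' a' hlabel, hpred, GateOp.apply_map, C.val_of_label x a hg]
      exact o.apply_congr ih

end Values

section Depth

variable {C : ExtCircuit n l m}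

theorem Path.trans {g h h' : C.Gates} {k k' : ℕ} (p : C.Path g h k) (q : C.Path h h' k') :
    C.Path g h' (k + k') := by
  induction q with
  | nil => exact p
  | snoc _ e ih => exact .snoc ih e

theorem exists_path {g h : C.Gates} (p : Relation.ReflTransGen C.Edge g h) :
    ∃ k, C.Path g h k := by
  induction p with
  | refl => exact ⟨0, .nil _⟩
  | tail _ e ih => exact ih.imp' _ fun _ p => .snoc p e

theorem Path.add_le {rank : C.Gates → ℕ} (hrank : ∀ g h, C.Edge g h → rank g < rank h)
    {g h : C.Gates} {k : ℕ} (p : C.Path g h k) : rank g + k ≤ rank h := by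
  induction p with
  | nil => exact le_rfl
  | snoc _ e ih => exact Nat.succ_le_of_lt (ih.trans_lt (hrank _ _ e))

variable (C)

theorem depth_le_of_rank {rank : C.Gates → ℕ} (hrank : ∀ g h, C.Edge g h → rank g < rank h)
    {K : ℕ} (hK : ∀ g, rank g ≤ K) : C.depth ≤ K := by
  apply csSup_le'
  rintro k ⟨g, h, p⟩
  exact (Nat.le_add_left _ _).trans ((p.add_le hrank).trans (hK h))

/-- The maximal length of a directed path that ends in a given gate. -/
def height : C.Gates → ℕ :=
  C.wellFounded_edge.fix fun g rec => (C.pred g).attach.sup fun p => rec p.1 p.2 + 1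

theorem height_eq (g : C.Gates) : C.height g = (C.pred g).sup fun p => C.height p + 1 := by
  rw [← Finset.sup_attach]
  exact C.wellFounded_edge.fix_eq _ _

theorem height_lt_height {g h : C.Gates} (e : C.Edge g h) : C.height g < C.height h := by
  rw [C.height_eq h]
  exact Finset.le_sup (f := fun p => C.height p + 1) e

theorem exists_path_height (g : C.Gates) : ∃ h, C.Path h g (C.height g) := by
  induction g using C.wellFounded_edge.induction with
  | _ g ih =>
    rcases (C.pred g).eq_empty_or_nonempty with hg | hg
    · exact ⟨g, by rw [C.height_eq, hg]; exact .nil g⟩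
    · obtain ⟨p, hp, hsup⟩ := Finset.exists_mem_eq_sup _ hg fun p => C.height p + 1
      obtain ⟨h, path⟩ := ih p hp
      exact ⟨h, by rw [C.height_eq, hsup]; exact path.snoc hp⟩

theorem bddAbove_pathLengths : BddAbove {k | ∃ g h, C.Path g h k} := by
  refine ⟨Finset.univ.sup C.height, ?_⟩
  rintro k ⟨g, h, p⟩
  have hk : k ≤ C.height h :=
    (Nat.le_add_left _ _).trans (p.add_le fun _ _ => C.height_lt_height)
  exact hk.trans (Finset.le_sup (Finset.mem_univ h))

theorem height_le_depth (g : C.Gates) : C.height g ≤ C.depth := by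
  obtain ⟨h, p⟩ := C.exists_path_height g
  exact le_csSup C.bddAbove_pathLengths ⟨h, g, p⟩

variable {C} in
theorem Path.le_ioDepth {i : Fin n} {j : Fin m} {k : ℕ} (p : C.Path (.inp i) (.out j) k) :
    k ≤ C.ioDepth := by
  refine le_csSup (C.bddAbove_pathLengths.mono ?_) ⟨i, j, p⟩
  rintro _ ⟨i, j, q⟩
  exact ⟨_, _, q⟩

theorem size_eq : C.size = n + l + (m + Fintype.card C.Inner) := by
  rw [size, Fintype.card_congr (Gate.equivSum n l m C.Inner)]
  simp only [Fintype.card_sum, Fintype.card_fin]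

end Depth

/-! ## Pruning -/

section Pruning

variable (C : ExtCircuit n l m)

/-- The gate is reachable from an input gate. -/
def FromInp (g : C.Gates) : Prop := ∃ j, Relation.ReflTransGen C.Edge (.inp j) g

/-- An output gate is reachable from the gate. -/
def ToOut (g : C.Gates) : Prop := ∃ j, Relation.ReflTransGen C.Edge g (.out j)

/-- The gate lies on a directed path from an input gate to an output gate; these are the gates
that the depth of a non-extended circuit takes into account. -/
def Live (g : C.Gates) : Prop := C.FromInp g ∧ C.ToOut g

variable {C}

theorem FromInp.edge {g h : C.Gates} (hg : C.FromInp g) (e : C.Edge g h) : C.FromInp h :=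
  hg.imp fun _ p => p.tail e

theorem ToOut.edge {g h : C.Gates} (hh : C.ToOut h) (e : C.Edge g h) : C.ToOut g :=
  hh.imp fun _ p => p.head e

theorem val_eq_of_not_fromInp {g : C.Gates} (hg : ¬ C.FromInp g) (x x' : Fin n → ℝ)
    (a : Fin l → ℝ) : C.val x a g = C.val x' a g := by
  induction g using C.wellFounded_edge.induction with
  | _ g ih =>
    rcases hlabel : C.label g with _ | o
    · cases g with
      | inp j => exact absurd ⟨j, .refl⟩ hg
      | aux j => rw [val_aux, val_aux]
      | out j => cases hlabel
      | inner g => cases hlabel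
    · rw [C.val_of_label x a hlabel, C.val_of_label x' a hlabel]
      exact o.apply_congr fun p hp => ih p hp fun h => hg (h.edge hp)

theorem Live.of_edge_fn {g : C.Inner} {f : ℝ → ℝ} (hf : C.op g = .fn f)
    (hg : C.Live (.inner g)) {h : C.Gates} (e : C.Edge (.inner g) h) : C.Live h := by
  obtain ⟨j, p⟩ := hg.2
  obtain hj | ⟨h', e', p⟩ := Relation.ReflTransGen.cases_head p
  · cases hj
  · exact ⟨hg.1.edge e, j, (C.succ_fn g f hf).unique e e' ▸ p⟩

variable (C)

open Classical in
/-- The predecessors of a gate in the pruned circuit: inner gates that are not live lose all their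
incoming edges. -/
noncomputable def prunePred : C.Gates → Finset C.Gates
  | .out j => C.pred (.out j)
  | g => if C.Live g then C.pred g else ∅

open Classical in
/-- The labels of the pruned circuit: inner gates that are not live become constants. -/
noncomputable def pruneOp (g : C.Inner) : GateOp :=
  if C.Live (.inner g) then C.op g else .const (C.val 0 0 (.inner g))

variable {C}

theorem prunePred_of_live {g : C.Gates} (hg : C.Live g) : C.prunePred g = C.pred g := by
  cases g with
  | out j => rfl
  | _ => exact if_pos hg

theorem prunePred_of_not_live {g : C.Gates} (hg : ¬ C.Live g) (hout : ∀ j, g ≠ .out j) :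
    C.prunePred g = ∅ := by
  cases g with
  | out j => exact absurd rfl (hout j)
  | _ => exact if_neg hg

theorem prunePred_subset (g : C.Gates) : C.prunePred g ⊆ C.pred g := by
  by_cases hg : C.Live g
  · exact (prunePred_of_live hg).subset
  · cases g with
    | out j => exact subset_rfl
    | _ => exact (prunePred_of_not_live hg nofun).trans_subset (Finset.empty_subset _)

theorem pruneOp_of_live {g : C.Inner} (hg : C.Live (.inner g)) : C.pruneOp g = C.op g :=
  if_pos hg

theorem pruneOp_of_not_live {g : C.Inner} (hg : ¬ C.Live (.inner g)) :
    C.pruneOp g = .const (C.val 0 0 (.inner g)) :=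
  if_neg hg

theorem pruneOp_eq_fn {g : C.Inner} {f : ℝ → ℝ} (h : C.pruneOp g = .fn f) :
    C.Live (.inner g) ∧ C.op g = .fn f := by
  by_cases hg : C.Live (.inner g)
  · exact ⟨hg, pruneOp_of_live hg ▸ h⟩
  · cases (pruneOp_of_not_live hg).symm.trans h

/-- The circuit in which all inner gates that are not live are replaced by constants. For
non-extended circuits this changes no output, while all paths of the result, not only those
from input gates to output gates, are short. -/
noncomputable def prune (C : ExtCircuit n l m) : ExtCircuit n l m where
  Inner := C.Inner
  fintypeInner := C.fintypeInner
  op := C.pruneOp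
  pred := C.prunePred
  acyclic g hg := C.acyclic g (Relation.TransGen.mono (fun _ b h => prunePred_subset b h) _ _ hg)
  pred_inp j := Finset.subset_empty.1 (C.pred_inp j ▸ prunePred_subset (.inp j))
  pred_aux j := Finset.subset_empty.1 (C.pred_aux j ▸ prunePred_subset (.aux j))
  pred_out := C.pred_out
  out_notMem_pred j g hg := C.out_notMem_pred j g (prunePred_subset g hg)
  pred_const g c h := by
    by_cases hg : C.Live (.inner g)
    · rw [prunePred_of_live hg]
      exact C.pred_const g c (pruneOp_of_live hg ▸ h)
    · exact prunePred_of_not_live hg nofun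
  pred_fn g f h := by
    obtain ⟨hg, h⟩ := pruneOp_eq_fn h
    rw [prunePred_of_live hg]
    exact C.pred_fn g f h
  succ_fn g f h := by
    obtain ⟨hg, h⟩ := pruneOp_eq_fn h
    obtain ⟨s, hs, hunique⟩ := C.succ_fn g f h
    refine ⟨s, ?_, fun s' hs' => hunique s' (prunePred_subset s' hs')⟩
    exact (prunePred_of_live (hg.of_edge_fn h hs)).superset hs

theorem prune_edge {g h : C.Gates} (e : C.prune.Edge g h) : C.Edge g h :=
  prunePred_subset h e

theorem UsesOnly.prune {B : Set (ℝ → ℝ)} (h : C.UsesOnly B) : C.prune.UsesOnly B :=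
  fun g f hf => h g f (pruneOp_eq_fn hf).2

theorem prune_label_of_live {g : C.Gates} (hg : C.Live g) : C.prune.label g = C.label g := by
  cases g with
  | inner g => exact congrArg some (pruneOp_of_live hg)
  | _ => rfl

theorem prune_val (C : ArithCircuit n m) (x : Fin n → ℝ) {g : C.Gates} (hg : C.ToOut g) :
    C.prune.val x 0 g = C.val x 0 g := by
  induction g using C.wellFounded_edge.induction with
  | _ g ih =>
    have hpred (o : GateOp) : o.apply (C.pred g) (C.prune.val x 0) =
        o.apply (C.pred g) (C.val x 0) := o.apply_congr fun p hp => ih p hp (hg.edge hp)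
    match g with
    | .inp j => exact (C.prune.val_inp x 0 j).trans (C.val_inp x 0 j).symm
    | .out j =>
      exact (C.prune.val_of_label x 0 (g := .out j) rfl).trans
        ((hpred .add).trans (C.val_of_label x 0 (g := .out j) rfl).symm)
    | .inner g =>
      by_cases hinp : C.FromInp (.inner g)
      · have hlabel := (prune_label_of_live ⟨hinp, hg⟩).trans rfl
        rw [C.prune.val_of_label x 0 hlabel, C.val_of_label x 0 (g := .inner g) rfl, ← hpred]
        exact congrArg₂ _ (prunePred_of_live ⟨hinp, hg⟩) rfl
      · have hop := pruneOp_of_not_live fun hlive => hinp hlive.1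
        exact (C.prune.val_of_label x 0 (g := .inner g) (congrArg some hop)).trans
          (val_eq_of_not_fromInp hinp 0 x 0)

theorem prune_eval (C : ArithCircuit n m) (x : Fin n → ℝ) : C.prune.eval x 0 = C.eval x 0 :=
  funext fun j => C.prune_val x ⟨j, .refl⟩

variable (C)

theorem prune_path_le_one_of_not_live {g h : C.Gates} {k : ℕ} (p : C.prune.Path g h k)
    (hh : ¬ C.Live h) : k ≤ 1 := by
  have hout {b b' : C.Gates} (e : C.prune.Edge b b') (hb' : ¬ C.Live b') : ∃ j, b' = .out j := by
    by_contra! hne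
    exact Finset.notMem_empty b (prunePred_of_not_live hb' hne ▸ e)
  rcases p with _ | ⟨q, e⟩
  · exact Nat.zero_le 1
  · obtain ⟨j, rfl⟩ := hout e hh
    rcases q with _ | ⟨_, e'⟩
    · exact le_rfl
    · obtain ⟨j', rfl⟩ := hout e' fun hlive => hh ⟨hlive.1.edge (prune_edge e), j, .refl⟩
      exact absurd e (C.prune.out_notMem_pred j' _)

theorem exists_path_inp_of_prune_path {g h : C.prune.Gates} {k : ℕ} (p : C.prune.Path g h k)
    (hh : C.Live h) : ∃ j k', C.Path (.inp j) h k' ∧ k ≤ k' + 2 := by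
  have hinp : ∃ j k', C.Path (.inp j) h k' := hh.1.imp fun _ r => exists_path r
  induction p with
  | nil => exact hinp.imp fun _ => .imp fun _ q => ⟨q, Nat.zero_le _⟩
  | @snoc h h' k p e ih =>
    by_cases hlive : C.Live h
    · obtain ⟨j, k', q, hk⟩ := ih hlive (hlive.1.imp fun _ r => exists_path r)
      exact ⟨j, k' + 1, q.snoc (prune_edge e), Nat.succ_le_succ hk⟩
    · have hk := C.prune_path_le_one_of_not_live p hlive
      exact hinp.imp fun _ => .imp fun _ q => ⟨q, by omega⟩

theorem prune_depth_le : C.prune.depth ≤ C.ioDepth + 2 := by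
  apply csSup_le'
  rintro k ⟨g, h, p⟩
  by_cases hh : C.Live h
  · obtain ⟨j, k', q, hk⟩ := C.exists_path_inp_of_prune_path p hh
    obtain ⟨j', r⟩ := hh.2
    obtain ⟨k'', r⟩ := exists_path r
    have := (q.trans r).le_ioDepth
    omega
  · exact (C.prune_path_le_one_of_not_live p hh).trans (by omega)

end Pruning

/-! ## Composition of circuits -/

section Shallow

/-- The predecessors in the circuit that applies a single gate to its `k` inputs. -/
def ofOpPred (k : ℕ) : Gate k 0 1 Unit → Finset (Gate k 0 1 Unit)
  | .out _ => {.inner ()}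
  | .inner _ => Finset.univ.map ⟨Gate.inp, fun _ _ => Gate.inp.inj⟩
  | _ => ∅

theorem stage_lt_of_mem_ofOpPred {k : ℕ} {g h : Gate k 0 1 Unit} (e : g ∈ ofOpPred k h) :
    g.stage < h.stage := by
  rcases h with _ | _ | _ | _ <;> rcases g with _ | _ | _ | _ <;> simp_all [ofOpPred, Gate.stage]

/-- The circuit that applies a single gate labelled `o` to its `k` inputs. -/
def ofOp (o : GateOp) (k : ℕ) (h : o.HasFanIn k) : ArithCircuit k 1 where
  Inner := Unit
  fintypeInner := inferInstance
  op _ := o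
  pred := ofOpPred k
  acyclic := not_transGen_of_rank Gate.stage fun _ _ => stage_lt_of_mem_ofOpPred
  pred_inp _ := rfl
  pred_aux _ := rfl
  pred_out _ := rfl
  out_notMem_pred _ g e := (stage_lt_of_mem_ofOpPred e).not_ge g.stage_le_two
  pred_const _ c hc := by
    obtain rfl : k = 0 := by rwa [hc] at h
    rfl
  pred_fn _ f hf := by
    obtain rfl : k = 1 := by rwa [hf] at h
    rfl
  succ_fn _ f _ := by
    refine ⟨.out 0, Finset.mem_singleton_self _, ?_⟩
    rintro (_ | _ | j | _) e
    · simp [ofOpPred] at e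
    · simp [ofOpPred] at e
    · rw [Subsingleton.elim j 0]
    · simp [ofOpPred] at e

theorem ofOp_eval {o : GateOp} {k : ℕ} (h : o.HasFanIn k) (x : Fin k → ℝ) (j : Fin 1) :
    (ofOp o k h).eval x 0 j = o.apply Finset.univ x := by
  refine ((ofOp o k h).val_out_of_pred_eq x 0 (g := .inner ()) rfl).trans ?_
  refine ((ofOp o k h).val_of_label x 0 (g := .inner ()) rfl).trans ?_
  exact (o.apply_map ..).trans (o.apply_congr fun i _ => val_inp ..)

theorem ofOp_depth_le {o : GateOp} {k : ℕ} (h : o.HasFanIn k) : (ofOp o k h).depth ≤ 2 :=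
  depth_le_of_rank _ (fun _ _ => stage_lt_of_mem_ofOpPred) Gate.stage_le_two

variable (σ : Fin m → Fin n ⊕ Fin l)

/-- The predecessors in the circuit whose `j`-th output is the value of the memory gate `σ j`. -/
def selectPred : Gate n l m Empty → Finset (Gate n l m Empty)
  | .out j => {Sum.elim Gate.inp Gate.aux (σ j)}
  | _ => ∅

theorem stage_lt_of_mem_selectPred {g h : Gate n l m Empty} (e : g ∈ selectPred σ h) :
    g.stage < h.stage := by
  rcases h with _ | _ | j | _
  · simp [selectPred] at e
  · simp [selectPred] at e
  · rcases h : σ j <;> simp_all [selectPred, Gate.stage]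
  · simp [selectPred] at e

/-- The circuit without inner gates whose `j`-th output is the value of the memory gate `σ j`. -/
def select : ExtCircuit n l m where
  Inner := Empty
  fintypeInner := inferInstance
  op := Empty.elim
  pred := selectPred σ
  acyclic := not_transGen_of_rank Gate.stage fun _ _ => stage_lt_of_mem_selectPred σ
  pred_inp _ := rfl
  pred_aux _ := rfl
  pred_out _ := rfl
  out_notMem_pred _ g e := (stage_lt_of_mem_selectPred σ e).not_ge g.stage_le_two
  pred_const g := g.elim
  pred_fn g := g.elim
  succ_fn g := g.elim

theorem select_eval (x : Fin n → ℝ) (a : Fin l → ℝ) (j : Fin m) :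
    (select σ).eval x a j = Sum.elim x a (σ j) := by
  rw [eval, val_out_of_pred_eq _ _ _ (g := Sum.elim Gate.inp Gate.aux (σ j)) rfl]
  rcases σ j with i | i
  · exact val_inp ..
  · exact val_aux ..

theorem select_depth_le : (select σ).depth ≤ 2 :=
  depth_le_of_rank _ (fun _ _ => stage_lt_of_mem_selectPred σ) Gate.stage_le_two

end Shallow

section Comp

variable {k : ℕ} (D : ArithCircuit k m) (C : Fin k → ExtCircuit n l 1)

/-- The inner gates of the composition of `D` with the circuits `C j`: those of the `C j`, one
wire for each `j`, which is both the output gate of `C j` and the `j`-th input gate of `D`, and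
those of `D`. -/
abbrev CompInner : Type := (Σ j, (C j).Inner) ⊕ Fin k ⊕ D.Inner

/-- The gate of the composition that the `j`-th input gate of `D` becomes. -/
abbrev wire (j : Fin k) : Gate n l m (CompInner D C) := .inner (.inr (.inl j))

theorem wire_injective : Function.Injective (wire D C) := fun _ _ h =>
  Sum.inl_injective (Sum.inr_injective (Gate.inner.inj h))

/-- The gates of `C j` as gates of the composition. -/
def argGate (j : Fin k) : (C j).Gates ↪ Gate n l m (CompInner D C) where
  toFun
    | .inp i => .inp i
    | .aux i => .aux i
    | .out _ => wire D C j
    | .inner g => .inner (.inl ⟨j, g⟩)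
  inj' := by
    rintro (_ | _ | _ | _) (_ | _ | _ | _) h <;> simp_all [eq_iff_true_of_subsingleton]

/-- The gates of `D` as gates of the composition. -/
def mainGate : D.Gates ↪ Gate n l m (CompInner D C) where
  toFun
    | .inp j => wire D C j
    | .aux i => i.elim0
    | .out i => .out i
    | .inner g => .inner (.inr (.inr g))
  inj' := by
    rintro (_ | _ | _ | _) (_ | _ | _ | _) h <;> first | exact Fin.elim0 ‹Fin 0› | simp_all

/-- The labels of the composition; wires copy their only predecessor. -/
def compOp : CompInner D C → GateOp
  | .inl ⟨j, g⟩ => (C j).op g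
  | .inr (.inl _) => .add
  | .inr (.inr g) => D.op g

/-- The predecessors of the gates of the composition. -/
def compPred : Gate n l m (CompInner D C) → Finset (Gate n l m (CompInner D C))
  | .inp _ => ∅
  | .aux _ => ∅
  | .out i => (D.pred (.out i)).map (mainGate D C)
  | .inner (.inl ⟨j, g⟩) => ((C j).pred (.inner g)).map (argGate D C j)
  | .inner (.inr (.inl j)) => ((C j).pred (.out 0)).map (argGate D C j)
  | .inner (.inr (.inr g)) => (D.pred (.inner g)).map (mainGate D C)

variable {D C}

theorem compPred_argGate {j : Fin k} (g : (C j).Gates) :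
    compPred D C (argGate D C j g) = ((C j).pred g).map (argGate D C j) := by
  cases g with
  | inp i => rw [(C j).pred_inp]; rfl
  | aux i => rw [(C j).pred_aux]; rfl
  | out i => rw [Subsingleton.elim i 0]; rfl
  | inner g => rfl

theorem compPred_mainGate {g : D.Gates} (hg : ∀ j, g ≠ .inp j) :
    compPred D C (mainGate D C g) = (D.pred g).map (mainGate D C) := by
  cases g with
  | inp j => exact absurd rfl (hg j)
  | aux i => exact i.elim0
  | _ => rfl

theorem exists_edge_of_mem_compPred {p q : Gate n l m (CompInner D C)}
    (h : p ∈ compPred D C q) :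
    (∃ j p' q', (C j).Edge p' q' ∧ argGate D C j p' = p ∧ argGate D C j q' = q) ∨
      ∃ p' q', D.Edge p' q' ∧ mainGate D C p' = p ∧ mainGate D C q' = q := by
  match q with
  | .out i =>
    obtain ⟨p', e, rfl⟩ := Finset.mem_map.1 h
    exact .inr ⟨p', .out i, e, rfl, rfl⟩
  | .inner (.inl ⟨j, g⟩) =>
    obtain ⟨p', e, rfl⟩ := Finset.mem_map.1 h
    exact .inl ⟨j, p', .inner g, e, rfl, rfl⟩
  | .inner (.inr (.inl j)) =>
    obtain ⟨p', e, rfl⟩ := Finset.mem_map.1 h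
    exact .inl ⟨j, p', .out 0, e, rfl, rfl⟩
  | .inner (.inr (.inr g)) =>
    obtain ⟨p', e, rfl⟩ := Finset.mem_map.1 h
    exact .inr ⟨p', .inner g, e, rfl, rfl⟩

variable (D C)

/-- A rank function for the composition that places `D` above all circuits `C j`. -/
noncomputable def compRank : Gate n l m (CompInner D C) → ℕ
  | .inp _ => 0
  | .aux _ => 0
  | .out i => (Finset.univ.sup fun j => (C j).depth) + D.height (.out i)
  | .inner (.inl ⟨j, g⟩) => (C j).height (.inner g)
  | .inner (.inr (.inl _)) => Finset.univ.sup fun j => (C j).depth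
  | .inner (.inr (.inr g)) => (Finset.univ.sup fun j => (C j).depth) + D.height (.inner g)

variable {D C}

theorem compRank_mainGate (g : D.Gates) :
    compRank D C (mainGate D C g) = (Finset.univ.sup fun j => (C j).depth) + D.height g := by
  cases g with
  | inp j =>
    rw [D.height_eq, D.pred_inp]
    rfl
  | aux i => exact i.elim0
  | _ => rfl

theorem compRank_argGate_of_ne_out {j : Fin k} {g : (C j).Gates} (hg : ∀ i, g ≠ .out i) :
    compRank D C (argGate D C j g) = (C j).height g := by
  cases g with
  | inp i =>
    rw [(C j).height_eq, (C j).pred_inp]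
    rfl
  | aux i =>
    rw [(C j).height_eq, (C j).pred_aux]
    rfl
  | out i => exact absurd rfl (hg i)
  | inner g => rfl

theorem height_le_compRank_argGate {j : Fin k} (g : (C j).Gates) :
    (C j).height g ≤ compRank D C (argGate D C j g) := by
  by_cases hg : ∀ i, g ≠ .out i
  · exact (compRank_argGate_of_ne_out hg).ge
  · push Not at hg
    obtain ⟨i, rfl⟩ := hg
    exact ((C j).height_le_depth _).trans
      (Finset.le_sup (f := fun j => (C j).depth) (Finset.mem_univ j))

theorem compRank_lt {p q : Gate n l m (CompInner D C)} (h : p ∈ compPred D C q) :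
    compRank D C p < compRank D C q := by
  obtain ⟨j, p', q', e, rfl, rfl⟩ | ⟨p', q', e, rfl, rfl⟩ := exists_edge_of_mem_compPred h
  · have hp' : ∀ i, p' ≠ .out i := by
      rintro i rfl
      exact (C j).out_notMem_pred i q' e
    rw [compRank_argGate_of_ne_out hp']
    exact ((C j).height_lt_height e).trans_le (height_le_compRank_argGate q')
  · rw [compRank_mainGate, compRank_mainGate]
    exact Nat.add_lt_add_left (D.height_lt_height e) _

theorem existsUnique_succ_of_compOp_eq_fn {g : CompInner D C} {f : ℝ → ℝ}
    (h : compOp D C g = .fn f) : ∃! q, Gate.inner g ∈ compPred D C q := by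
  match g with
  | .inl ⟨j, g⟩ =>
    obtain ⟨s, hs, hunique⟩ := (C j).succ_fn g f h
    refine ⟨argGate D C j s, ?_, fun q hq => ?_⟩
    · exact (compPred_argGate s).superset (Finset.mem_map_of_mem (argGate D C j) hs)
    · obtain ⟨j', p', q', e, hp, rfl⟩ | ⟨p', q', e, hp, rfl⟩ := exists_edge_of_mem_compPred hq
      · rcases p' with _ | _ | _ | _ <;> cases hp
        exact congrArg (argGate D C j) (hunique q' e)
      · rcases p' with _ | i | _ | _
        · cases hp
        · exact i.elim0
        · cases hp
        · cases hp
  | .inr (.inr g) =>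
    obtain ⟨s, hs, hunique⟩ := D.succ_fn g f h
    refine ⟨mainGate D C s, ?_, fun q hq => ?_⟩
    · have hne : ∀ j, s ≠ .inp j := by
        rintro j rfl
        simp only [D.pred_inp, Finset.notMem_empty] at hs
      exact (compPred_mainGate hne).superset (Finset.mem_map_of_mem (mainGate D C) hs)
    · obtain ⟨j', p', q', e, hp, rfl⟩ | ⟨p', q', e, hp, rfl⟩ := exists_edge_of_mem_compPred hq
      · rcases p' with _ | _ | _ | _ <;> cases hp
      · obtain rfl : p' = .inner g := (mainGate D C).injective hp
        exact congrArg (mainGate D C) (hunique q' e)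

theorem argGate_ne_out {j : Fin k} (g : (C j).Gates) (i : Fin m) : argGate D C j g ≠ .out i := by
  cases g <;> simp [argGate]

variable (D C)

/-- The circuit that computes the outputs of the circuits `C j` and applies `D` to them. -/
def comp : ExtCircuit n l m where
  Inner := CompInner D C
  fintypeInner := inferInstance
  op := compOp D C
  pred := compPred D C
  acyclic := not_transGen_of_rank (compRank D C) fun _ _ => compRank_lt
  pred_inp _ := rfl
  pred_aux _ := rfl
  pred_out i := (Finset.card_map _).trans (D.pred_out i)
  out_notMem_pred i q h := by
    obtain ⟨j, p', q', _, hp, rfl⟩ | ⟨p', q', e, hp, rfl⟩ := exists_edge_of_mem_compPred h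
    · exact argGate_ne_out p' i hp
    · obtain rfl : p' = .out i := (mainGate D C).injective hp
      exact D.out_notMem_pred i q' e
  pred_const g c h := by
    match g with
    | .inl ⟨j, g⟩ => exact (Finset.map_eq_empty).2 ((C j).pred_const g c h)
    | .inr (.inr g) => exact (Finset.map_eq_empty).2 (D.pred_const g c h)
  pred_fn g f h := by
    match g with
    | .inl ⟨j, g⟩ => exact (Finset.card_map _).trans ((C j).pred_fn g f h)
    | .inr (.inr g) => exact (Finset.card_map _).trans (D.pred_fn g f h)
  succ_fn _ _ := existsUnique_succ_of_compOp_eq_fn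

theorem comp_val_wire (x : Fin n → ℝ) (a : Fin l → ℝ) (j : Fin k) :
    (comp D C).val x a (wire D C j) = (C j).eval x a 0 := by
  refine val_map (C' := comp D C) x a (argGate D C j) (fun i => val_inp _ _ _ i)
    (fun i => val_aux _ _ _ i) (fun g o hg => ⟨?_, compPred_argGate g⟩) (.out 0)
  cases g with
  | inp i => cases hg
  | aux i => cases hg
  | _ => exact hg

theorem comp_eval (x : Fin n → ℝ) (a : Fin l → ℝ) :
    (comp D C).eval x a = D.eval (fun j => (C j).eval x a 0) 0 := by
  funext i
  refine val_map (C' := comp D C) _ _ (mainGate D C) (comp_val_wire D C x a)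
    (fun i => i.elim0) (fun g o hg => ⟨?_, compPred_mainGate ?_⟩) (.out i)
  · cases g with
    | inp i => cases hg
    | aux i => cases hg
    | _ => exact hg
  · rintro j rfl
    cases hg

variable {D C}

theorem UsesOnly.comp {B : Set (ℝ → ℝ)} (hD : D.UsesOnly B) (hC : ∀ j, (C j).UsesOnly B) :
    (comp D C).UsesOnly B := by
  rintro (⟨j, g⟩ | _ | g) f hf
  · exact hC j g f hf
  · cases hf
  · exact hD g f hf

theorem comp_depth_le {K : ℕ} (hK : ∀ j, (C j).depth ≤ K) : (comp D C).depth ≤ K + D.depth := by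
  have hsup : (Finset.univ.sup fun j => (C j).depth) ≤ K := Finset.sup_le fun j _ => hK j
  refine depth_le_of_rank _ (fun _ _ => compRank_lt) fun g => ?_
  match g with
  | .inp _ => exact Nat.zero_le _
  | .aux _ => exact Nat.zero_le _
  | .out i => exact Nat.add_le_add hsup (D.height_le_depth _)
  | .inner (.inl ⟨j, g⟩) =>
    exact (((C j).height_le_depth _).trans (hK j)).trans (Nat.le_add_right _ _)
  | .inner (.inr (.inl _)) => exact hsup.trans (Nat.le_add_right _ _)
  | .inner (.inr (.inr g)) => exact Nat.add_le_add hsup (D.height_le_depth _)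

theorem comp_card_inner_le {s : ℕ} (hs : ∀ j, Fintype.card (C j).Inner ≤ s) :
    Fintype.card (comp D C).Inner ≤ k * s + (k + Fintype.card D.Inner) := by
  have hsum := Finset.sum_le_card_nsmul Finset.univ _ s fun j _ => hs j
  rw [Finset.card_univ, Fintype.card_fin, smul_eq_mul] at hsum
  refine (Fintype.card_sum ..).trans_le ?_
  rw [Fintype.card_sigma, Fintype.card_sum, Fintype.card_fin]
  exact Nat.add_le_add_right hsum _

end Comp

end ExtCircuit

section Computable

variable {B : Set (ℝ → ℝ)} {n l s d : ℕ}

/-- `F` is computed by an extended circuit with function gates from `B`, at most `s` inner gates,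
and depth at most `d`. -/
def CircuitComputable (B : Set (ℝ → ℝ)) (s d : ℕ) (F : (Fin n → ℝ) → (Fin l → ℝ) → ℝ) : Prop :=
  ∃ C : ExtCircuit n l 1, C.UsesOnly B ∧ Fintype.card C.Inner ≤ s ∧ C.depth ≤ d ∧
    ∀ x a, C.eval x a 0 = F x a

namespace CircuitComputable

variable {F G : (Fin n → ℝ) → (Fin l → ℝ) → ℝ}

theorem mono {B' : Set (ℝ → ℝ)} {s' d' : ℕ} (hF : CircuitComputable B s d F) (hB : B ⊆ B')
    (hs : s ≤ s') (hd : d ≤ d') : CircuitComputable B' s' d' F := by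
  obtain ⟨C, hCB, hCs, hCd, hC⟩ := hF
  exact ⟨C, fun g f h => hB (hCB g f h), hCs.trans hs, hCd.trans hd, hC⟩

theorem memory (B : Set (ℝ → ℝ)) (v : Fin n ⊕ Fin l) :
    CircuitComputable B 0 2 fun x a => Sum.elim x a v :=
  ⟨.select fun _ => v, nofun, le_rfl, ExtCircuit.select_depth_le _,
    fun x a => ExtCircuit.select_eval _ x a 0⟩

theorem inp (B : Set (ℝ → ℝ)) (j : Fin n) :
    CircuitComputable B 0 2 fun (x : Fin n → ℝ) (_ : Fin l → ℝ) => x j :=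
  memory B (.inl j)

theorem aux (B : Set (ℝ → ℝ)) (j : Fin l) :
    CircuitComputable B 0 2 fun (_ : Fin n → ℝ) (a : Fin l → ℝ) => a j :=
  memory B (.inr j)

theorem comp {k s' d' : ℕ} {D : (Fin k → ℝ) → ℝ}
    (hD : CircuitComputable B s' d' fun x (_ : Fin 0 → ℝ) => D x)
    {F : Fin k → (Fin n → ℝ) → (Fin l → ℝ) → ℝ} (hF : ∀ j, CircuitComputable B s d (F j)) :
    CircuitComputable B (k * s + (k + s')) (d + d') fun x a => D fun j => F j x a := by
  obtain ⟨D, hDB, hDs, hDd, hD⟩ := hD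
  choose C hCB hCs hCd hC using hF
  refine ⟨D.comp C, hDB.comp hCB, ?_, ?_, fun x a => ?_⟩
  · exact (ExtCircuit.comp_card_inner_le hCs).trans (by gcongr)
  · exact (ExtCircuit.comp_depth_le hCd).trans (Nat.add_le_add_left hDd d)
  · simp only [ExtCircuit.comp_eval, hD, hC]

theorem gate {o : GateOp} (ho : ∀ f, o = .fn f → f ∈ B) {k : ℕ} (hk : o.HasFanIn k)
    {F : Fin k → (Fin n → ℝ) → (Fin l → ℝ) → ℝ} (hF : ∀ j, CircuitComputable B s d (F j)) :
    CircuitComputable B (k * s + k + 1) (d + 2) fun x a =>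
      o.apply Finset.univ fun j => F j x a := by
  have hD : CircuitComputable B 1 2 fun x (_ : Fin 0 → ℝ) => o.apply (Finset.univ (α := Fin k)) x :=
    ⟨.ofOp o k hk, fun _ => ho, le_rfl, ExtCircuit.ofOp_depth_le hk, fun x a => by
      rw [Subsingleton.elim a 0, ExtCircuit.ofOp_eval]⟩
  exact hD.comp hF

theorem const (B : Set (ℝ → ℝ)) (c : ℝ) :
    CircuitComputable B 1 2 fun (_ : Fin n → ℝ) (_ : Fin l → ℝ) => c := by
  simpa [GateOp.apply] using gate (B := B) (o := .const c) (s := 0) (d := 0) nofun rfl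
    (F := Fin.elim0) nofun

theorem fn {f : ℝ → ℝ} (hf : f ∈ B) (hF : CircuitComputable B s d F) :
    CircuitComputable B (s + 2) (d + 2) fun x a => f (F x a) := by
  simpa [GateOp.apply] using gate (B := B) (o := .fn f) (by rintro _ ⟨⟩; exact hf) rfl
    (F := fun _ : Fin 1 => F) fun _ => hF

theorem sum {α : Type*} (S : Finset α) {k : ℕ} (hS : S.card ≤ k)
    {F : α → (Fin n → ℝ) → (Fin l → ℝ) → ℝ} (hF : ∀ t ∈ S, CircuitComputable B s d (F t)) :
    CircuitComputable B (k * s + k + 1) (d + 2) fun x a => ∑ t ∈ S, F t x a := by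
  have hsum (x : Fin n → ℝ) (a : Fin l → ℝ) :
      ∑ t ∈ S, F t x a = ∑ j, F (S.equivFin.symm j) x a := by
    rw [← Finset.sum_coe_sort]
    exact (S.equivFin.symm.sum_comp fun t => F t x a).symm
  simp only [hsum]
  exact (gate (o := .add) nofun trivial fun j => hF _ (S.equivFin.symm j).2).mono
    subset_rfl (by gcongr) le_rfl

theorem mul (hF : CircuitComputable B s d F) (hG : CircuitComputable B s d G) :
    CircuitComputable B (2 * s + 3) (d + 2) fun x a => F x a * G x a := by
  have h := gate (B := B) (o := .mul) nofun trivial (F := ![F, G]) (Fin.forall_fin_two.2 ⟨hF, hG⟩)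
  simpa [GateOp.apply, Fin.prod_univ_two] using h

theorem pow (e : ℕ) (hF : CircuitComputable B s d F) :
    CircuitComputable B (e * s + e + 1) (d + 2) fun x a => F x a ^ e := by
  simpa [GateOp.apply] using gate (B := B) (o := .mul) nofun trivial
    (F := fun _ : Fin e => F) fun _ => hF

theorem polynomial_eval {p : Polynomial ℝ} {N : ℕ} (hp : p.natDegree < N)
    (hF : CircuitComputable B s d F) :
    CircuitComputable B (N * (2 * (N * s + N + 1) + 3) + N + 1) (d + 6) fun x a =>
      p.eval (F x a) := by
  simp only [Polynomial.eval_eq_sum_range' hp]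
  refine sum (Finset.range N) (Finset.card_range N).le fun e he => mul (d := d + 2) ?_ ?_
  · exact (const B (p.coeff e)).mono subset_rfl (by omega) (by omega)
  · have := Finset.mem_range.1 he
    exact (hF.pow e).mono subset_rfl (by gcongr) le_rfl

end CircuitComputable

end Computable

/-! ## Polynomial and polylogarithmic growth -/

section Growth

section RunningMaximum

variable {s : ℕ → ℕ} {g : ℕ → ℝ}

theorem isBigO_partialSups (hg : Monotone g) (hg0 : 0 ≤ g)
    (hg1 : (fun _ => (1 : ℝ)) =O[atTop] g) (hs : (fun n => (s n : ℝ)) =O[atTop] g) :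
    (fun n => (partialSups s n : ℝ)) =O[atTop] g := by
  obtain ⟨c, hc, hsc⟩ := hs.exists_nonneg
  obtain ⟨N, hN⟩ := eventually_atTop.1 hsc.bound
  have hbound (n : ℕ) : (partialSups s n : ℝ) ≤ partialSups s N * 1 + c * g n := by
    obtain ⟨k, hkn, hk⟩ : ∃ k ≤ n, partialSups s n = s k := exists_partialSups_eq s n
    rw [hk, mul_one]
    rcases le_total k N with hkN | hNk
    · exact le_add_of_le_of_nonneg (Nat.cast_le.2 (le_partialSups_of_le s hkN))
        (mul_nonneg hc (hg0 n))
    · have hsk := hN k hNk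
      rw [Real.norm_natCast, Real.norm_of_nonneg (hg0 k)] at hsk
      exact le_add_of_nonneg_of_le (Nat.cast_nonneg _)
        (hsk.trans (mul_le_mul_of_nonneg_left (hg hkn) hc))
  refine .trans (.of_norm_le fun n => ?_)
    ((hg1.const_mul_left (partialSups s N : ℝ)).add (isBigO_const_mul_self c g atTop))
  simpa only [Real.norm_natCast] using hbound n

theorem isBigO_comp_of_le (hg : Monotone g) (hg0 : 0 ≤ g) {t : ℕ → ℕ} (ht : Tendsto t atTop atTop)
    (hle : ∀ n, t n ≤ n) (hs : (fun n => (s n : ℝ)) =O[atTop] g) :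
    (fun n => (s (t n) : ℝ)) =O[atTop] g :=
  (hs.comp_tendsto ht).trans <| .of_norm_le fun n => by
    simpa only [Function.comp_apply, Real.norm_of_nonneg (hg0 _)] using hg (hle n)

end RunningMaximum

theorem monotone_natCast_pow (k : ℕ) : Monotone fun n : ℕ => (n : ℝ) ^ k :=
  fun _ _ h => pow_le_pow_left₀ (Nat.cast_nonneg _) (Nat.cast_le.2 h) k

theorem one_isBigO_natCast_pow (k : ℕ) : (fun _ => (1 : ℝ)) =O[atTop] fun n : ℕ => (n : ℝ) ^ k := by
  refine .of_bound' ((eventually_ge_atTop 1).mono fun n hn => ?_)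
  simpa using one_le_pow₀ (n := k) (Nat.one_le_cast (α := ℝ).2 hn)

theorem monotone_log_natCast_pow (i : ℕ) : Monotone fun n : ℕ => Real.log n ^ i := by
  refine fun m n h => pow_le_pow_left₀ (Real.log_natCast_nonneg m) ?_ i
  rcases m.eq_zero_or_pos with rfl | hm
  · simpa only [Nat.cast_zero, Real.log_zero] using Real.log_natCast_nonneg n
  · exact Real.log_le_log (Nat.cast_pos.2 hm) (Nat.cast_le.2 h)

theorem one_isBigO_log_natCast_pow (i : ℕ) :
    (fun _ => (1 : ℝ)) =O[atTop] fun n : ℕ => Real.log n ^ i := by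
  have hlog : Tendsto (fun n : ℕ => Real.log n) atTop atTop :=
    Real.tendsto_log_atTop.comp tendsto_natCast_atTop_atTop
  refine .of_bound' ((hlog.eventually_ge_atTop 1).mono fun n hn => ?_)
  simpa using (one_le_pow₀ hn (n := i)).trans (le_abs_self _)

theorem tendsto_natSqrt_atTop : Tendsto Nat.sqrt atTop atTop :=
  tendsto_atTop_atTop.2 fun b => ⟨b * b, fun _ h => Nat.le_sqrt.2 h⟩

namespace PolyBounded

variable {s t : ℕ → ℕ}

theorem mono (ht : PolyBounded t) (h : ∀ n, s n ≤ t n) : PolyBounded s :=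
  ht.imp fun _ hk => .trans (.of_norm_le fun n => by simpa using h n) hk

theorem const (c : ℕ) : PolyBounded fun _ => c :=
  ⟨0, by simpa using (one_isBigO_natCast_pow 0).const_mul_left (c : ℝ)⟩

theorem id : PolyBounded fun n : ℕ => n :=
  ⟨1, by simpa using isBigO_refl (fun n : ℕ => (n : ℝ)) atTop⟩

theorem mul (hs : PolyBounded s) (ht : PolyBounded t) : PolyBounded fun n => s n * t n := by
  obtain ⟨k, hk⟩ := hs
  obtain ⟨k', hk'⟩ := ht
  exact ⟨k + k', by simpa only [Nat.cast_mul, pow_add] using hk.mul hk'⟩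

theorem add (hs : PolyBounded s) (ht : PolyBounded t) : PolyBounded fun n => s n + t n := by
  obtain ⟨k, hk⟩ := hs
  obtain ⟨k', hk'⟩ := ht
  have hle {e : ℕ} (he : e ≤ k + k') :
      (fun n : ℕ => (n : ℝ) ^ e) =O[atTop] fun n : ℕ => (n : ℝ) ^ (k + k') :=
    IsBigO.pow_of_le_right (f := fun n : ℕ => (n : ℝ))
      ((eventually_ge_atTop 1).mono fun _ => Nat.one_le_cast.2) he
  exact ⟨k + k', by
    simpa only [Nat.cast_add] using
      (hk.trans (hle (Nat.le_add_right k k'))).add (hk'.trans (hle (Nat.le_add_left k' k)))⟩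

theorem finsetSum {α : Type*} (S : Finset α) {f : α → ℕ → ℕ} (h : ∀ r ∈ S, PolyBounded (f r)) :
    PolyBounded fun n => ∑ r ∈ S, f r n := by
  induction S using Finset.cons_induction with
  | empty => exact const 0
  | cons r S hr ih =>
    simp only [Finset.sum_cons]
    exact (h r (Finset.mem_cons_self r S)).add (ih fun t ht => h t (Finset.mem_cons_of_mem ht))

theorem partialSups (hs : PolyBounded s) : PolyBounded (partialSups s) :=
  hs.imp fun k => isBigO_partialSups (monotone_natCast_pow k) (fun _ => by positivity)
    (one_isBigO_natCast_pow k)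

theorem comp_sqrt (hs : PolyBounded s) : PolyBounded fun n => s n.sqrt :=
  hs.imp fun k => isBigO_comp_of_le (monotone_natCast_pow k) (fun _ => by positivity)
    tendsto_natSqrt_atTop Nat.sqrt_le_self

end PolyBounded

namespace PolylogBounded

variable {i : ℕ} {s t : ℕ → ℕ}

theorem mono (ht : PolylogBounded i t) (h : ∀ n, s n ≤ t n) : PolylogBounded i s :=
  .trans (.of_norm_le fun n => by simpa using h n) ht

theorem const (i c : ℕ) : PolylogBounded i fun _ => c := by
  simpa [PolylogBounded] using (one_isBigO_log_natCast_pow i).const_mul_left (c : ℝ)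

theorem add (hs : PolylogBounded i s) (ht : PolylogBounded i t) :
    PolylogBounded i fun n => s n + t n := by
  simpa only [PolylogBounded, Nat.cast_add] using IsBigO.add hs ht

theorem finsetSum {α : Type*} (S : Finset α) {f : α → ℕ → ℕ}
    (h : ∀ r ∈ S, PolylogBounded i (f r)) : PolylogBounded i fun n => ∑ r ∈ S, f r n := by
  simpa only [PolylogBounded, Nat.cast_sum] using IsBigO.fun_sum h

theorem partialSups (hs : PolylogBounded i s) : PolylogBounded i (partialSups s) :=
  isBigO_partialSups (monotone_log_natCast_pow i)
    (fun n => pow_nonneg (Real.log_natCast_nonneg n) i) (one_isBigO_log_natCast_pow i) hs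

theorem comp_sqrt (hs : PolylogBounded i s) : PolylogBounded i fun n => s n.sqrt :=
  isBigO_comp_of_le (monotone_log_natCast_pow i)
    (fun n => pow_nonneg (Real.log_natCast_nonneg n) i) tendsto_natSqrt_atTop Nat.sqrt_le_self hs

end PolylogBounded

end Growth

theorem CircuitFamily.eval_ofFn (C : CircuitFamily) {n : ℕ} (x : Fin n → ℝ) :
    C.eval (List.ofFn x) = List.ofFn ((C.circuit n).eval x Fin.elim0) := by
  suffices h : ∀ (v : List ℝ) (hv : v.length = n),
      C.eval v = List.ofFn ((C.circuit n).eval (fun j => v.get (j.cast hv.symm)) Fin.elim0) by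
    simpa only [List.get_ofFn, Fin.cast_cast, Fin.cast_eq_self] using h _ List.length_ofFn
  rintro v rfl
  rfl

theorem exists_circuitComputable_of_mem_FAC {i : ℕ} {B : Set (ℝ → ℝ)} {f : List ℝ → ℝ}
    (hf : (fun v => [f v]) ∈ FAC i B) :
    ∃ s d : ℕ → ℕ, PolyBounded s ∧ PolylogBounded i d ∧ ∀ {k n : ℕ}, k ≤ n →
      CircuitComputable B (s n) (d n) fun (x : Fin k → ℝ) (_ : Fin 0 → ℝ) => f (List.ofFn x) := by
  obtain ⟨C, ⟨hB, hs, hd⟩, hf⟩ := hf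
  refine ⟨partialSups fun n => (C.circuit n).size,
    partialSups fun n => (C.circuit n).ioDepth + 2, hs.partialSups,
    (hd.add (.const i 2)).partialSups, fun {k n} hkn => ?_⟩
  suffices h : CircuitComputable B (C.circuit k).size ((C.circuit k).ioDepth + 2)
      fun (x : Fin k → ℝ) (_ : Fin 0 → ℝ) => f (List.ofFn x) from
    h.mono subset_rfl (le_partialSups_of_le (fun n => (C.circuit n).size) hkn)
      (le_partialSups_of_le (fun n => (C.circuit n).ioDepth + 2) hkn)
  have heval (x : Fin k → ℝ) : List.ofFn ((C.circuit k).eval x Fin.elim0) = [f (List.ofFn x)] := by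
    rw [← C.eval_ofFn, hf]
  have hout : C.numOut k = 1 := by simpa using congrArg List.length (heval 0)
  have hCB := hB k
  generalize C.circuit k = D at *
  generalize C.numOut k = m at *
  subst hout
  refine ⟨D.prune, hCB.prune, ?_, D.prune_depth_le, fun x a => ?_⟩
  · rw [D.size_eq]
    exact (Nat.le_add_left _ _).trans (Nat.le_add_left _ _)
  · rw [Subsingleton.elim a 0, D.prune_eval, Subsingleton.elim 0 Fin.elim0]
    simpa using heval x

/-! ## Layers as functions of the encoding -/

section GraphEncoding

variable {n : ℕ}

/-- Position of the adjacency matrix entry `(w, u)` in the encoding of a graph. -/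
def adjIdx (w u : Fin n) : Fin (n * n + n) := Fin.castAdd n (finProdFinEquiv (w, u))

/-- Position of the feature value of `w` in the encoding of a graph. -/
def featIdx (w : Fin n) : Fin (n * n + n) := Fin.natAdd (n * n) w

/-- The polynomial of degree less than `n` that is `1` at `j` and `0` at the other natural numbers
below `n`. It makes equality tests on counters computable without sign gates. -/
noncomputable def indicatorPoly (n j : ℕ) : Polynomial ℝ :=
  Lagrange.basis (Finset.range n) (fun k : ℕ => (k : ℝ)) j

theorem indicatorPoly_eval {j k : ℕ} (hj : j < n) (hk : k < n) :
    (indicatorPoly n j).eval (k : ℝ) = if j = k then 1 else 0 := by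
  split_ifs with h
  · subst h
    exact Lagrange.eval_basis_self Nat.cast_injective.injOn (Finset.mem_range.2 hj)
  · exact Lagrange.eval_basis_of_ne h (Finset.mem_range.2 hk)

theorem natDegree_indicatorPoly_lt {j : ℕ} (hj : j < n) : (indicatorPoly n j).natDegree < n := by
  rw [indicatorPoly, Lagrange.natDegree_basis Nat.cast_injective.injOn (Finset.mem_range.2 hj),
    Finset.card_range]
  exact Nat.sub_lt (Nat.zero_lt_of_lt hj) Nat.one_pos

variable (x : Fin (n * n + n) → ℝ) (w : Fin n)

/-- The number of neighbours of `w` in `S`, for the graph encoded by `x`. -/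
def neighborCount (S : Finset (Fin n)) : ℝ := ∑ v ∈ S, x (adjIdx w v)

/-- The feature value of the neighbour of `w` with exactly `j` smaller neighbours, for the graph
encoded by `x`. -/
noncomputable def neighborFeature (j : ℕ) : ℝ :=
  ∑ u, x (adjIdx w u) *
    ((indicatorPoly n j).eval (neighborCount x w (Finset.Iio u)) * x (featIdx u))

/-- The value of `f` at the feature value of `w` followed by those of its neighbours, for the graph
encoded by `x`. As the degree of `w` is not known in advance, one value of `f` is computed for each
possible degree, and the appropriate one is selected. -/
noncomputable def aggregate (f : List ℝ → ℝ) : ℝ :=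
  ∑ t : Fin n, (indicatorPoly n t).eval (neighborCount x w Finset.univ) *
    f (x (featIdx w) :: List.ofFn fun j : Fin t => neighborFeature x w j)

/-- The new feature value of `w`, where the layer is selected by the one-hot vector `a`. -/
noncomputable def layer {d : ℕ} (f : Fin d → List ℝ → ℝ) (σ : Fin d → ℝ → ℝ) (a : Fin d → ℝ) : ℝ :=
  ∑ r, a r * σ r (aggregate x w (f r))

end GraphEncoding

namespace LabelledGraph

variable (G : LabelledGraph) (w : Fin G.numV)

theorem toFinset_nbrs [DecidableRel G.graph.Adj] :
    (G.nbrs w).toFinset = Finset.univ.filter (G.graph.Adj w) := by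
  ext u
  simp [nbrs]

theorem nodup_nbrs : (G.nbrs w).Nodup := (List.nodup_finRange _).filter _

theorem strictMono_get_nbrs : StrictMono (G.nbrs w).get :=
  List.sortedLT_iff_strictMono_get.1 ((List.pairwise_lt_finRange _).filter _).sortedLT

theorem length_nbrs_lt : (G.nbrs w).length < G.numV := by
  simpa only [nbrs, List.length_finRange] using
    List.length_filter_lt_length_iff_exists.2 ⟨w, List.mem_finRange w, by simp⟩

open Classical in
/-- The encoding of `G` with the feature values replaced by `h`, as a vector. -/
noncomputable def encodeVec (h : Fin G.numV → ℝ) : Fin (G.numV * G.numV + G.numV) → ℝ :=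
  Fin.append (fun p => G.graph.adjMatrix ℝ (finProdFinEquiv.symm p).1 (finProdFinEquiv.symm p).2) h

theorem encode_eq_ofFn (h : Fin G.numV → ℝ) :
    ({ G with feature := h } : LabelledGraph).encode = List.ofFn (G.encodeVec h) := by
  classical
  rw [encodeVec, List.ofFn_fin_append, List.ofFn_mul, encode, List.flatMap_def]
  simp only [List.ofFn_eq_map]
  have hpair (u v : Fin G.numV) (huv : (u * G.numV + v : ℕ) < G.numV * G.numV) :
      finProdFinEquiv.symm ⟨u * G.numV + v, huv⟩ = (u, v) := by
    rw [Equiv.symm_apply_eq]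
    ext
    simp [finProdFinEquiv, add_comm, mul_comm]
  simp only [hpair]

variable (h : Fin G.numV → ℝ)

open Classical in
theorem encodeVec_adjIdx (u : Fin G.numV) :
    G.encodeVec h (adjIdx w u) = if G.graph.Adj w u then 1 else 0 := by
  simp only [encodeVec, adjIdx, Fin.append_left, Equiv.symm_apply_apply,
    SimpleGraph.adjMatrix_apply]

theorem encodeVec_featIdx : G.encodeVec h (featIdx w) = h w := by
  simp [encodeVec, featIdx]

theorem sum_encodeVec_adjIdx_mul (φ : Fin G.numV → ℝ) :
    ∑ u, G.encodeVec h (adjIdx w u) * φ u = ∑ k, φ ((G.nbrs w).get k) := by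
  classical
  simp only [encodeVec_adjIdx, ite_mul, one_mul, zero_mul]
  rw [← Finset.sum_filter, ← toFinset_nbrs, List.sum_toFinset φ (G.nodup_nbrs w)]
  exact (Fin.sum_univ_fun_getElem (G.nbrs w) φ).symm

theorem neighborCount_univ :
    neighborCount (G.encodeVec h) w Finset.univ = ((G.nbrs w).length : ℝ) := by
  simpa [neighborCount] using G.sum_encodeVec_adjIdx_mul w h 1

theorem neighborCount_Iio (j : Fin (G.nbrs w).length) :
    neighborCount (G.encodeVec h) w (Finset.Iio ((G.nbrs w).get j)) = ((j : ℕ) : ℝ) := by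
  have hsum := G.sum_encodeVec_adjIdx_mul w h fun u => if u < (G.nbrs w).get j then 1 else 0
  simp only [mul_ite, mul_one, mul_zero, (G.strictMono_get_nbrs w).lt_iff_lt] at hsum
  rw [neighborCount, ← Finset.filter_gt_eq_Iio, Finset.sum_filter, hsum,
    Finset.sum_boole, Finset.filter_gt_eq_Iio, Fin.card_Iio]

theorem neighborFeature_encodeVec (j : Fin (G.nbrs w).length) :
    neighborFeature (G.encodeVec h) w j = h ((G.nbrs w).get j) := by
  have hlt (k : Fin (G.nbrs w).length) : (k : ℕ) < G.numV := k.2.trans (G.length_nbrs_lt w)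
  rw [neighborFeature, sum_encodeVec_adjIdx_mul]
  simp only [neighborCount_Iio, encodeVec_featIdx, indicatorPoly_eval (hlt _) (hlt _), ite_mul,
    one_mul, zero_mul, Fin.val_inj, Finset.sum_ite_eq, Finset.mem_univ, if_true]

theorem aggregate_encodeVec (f : List ℝ → ℝ) :
    aggregate (G.encodeVec h) w f = f (h w :: (G.nbrs w).map h) := by
  have hlt := G.length_nbrs_lt w
  rw [aggregate, Finset.sum_eq_single ⟨(G.nbrs w).length, hlt⟩]
  · rw [neighborCount_univ, indicatorPoly_eval hlt hlt, if_pos rfl, one_mul, encodeVec_featIdx]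
    simp only [neighborFeature_encodeVec, ← Function.comp_def, ← List.map_ofFn, List.ofFn_get]
  · intro t _ ht
    rw [neighborCount_univ, indicatorPoly_eval t.2 hlt, if_neg fun h => ht (Fin.ext h), zero_mul]
  · simp

theorem layer_encodeVec_single {d : ℕ} (f : Fin d → List ℝ → ℝ) (σ : Fin d → ℝ → ℝ) (r : Fin d) :
    layer (G.encodeVec h) w f σ (Pi.single r 1) = σ r (f r (h w :: (G.nbrs w).map h)) := by
  simp [layer, Pi.single_apply, aggregate_encodeVec]

end LabelledGraph

section LayerCircuits

theorem exists_circuitComputable_indicatorPoly_neighborCount :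
    ∃ s : ℕ → ℕ, PolyBounded s ∧ ∀ {n l j : ℕ} (B : Set (ℝ → ℝ)) (w : Fin n) (S : Finset (Fin n)),
      j < n → CircuitComputable B (s n) 10 fun x (_ : Fin l → ℝ) =>
        (indicatorPoly n j).eval (neighborCount x w S) := by
  refine ⟨_, ?_, fun {n l j} B w S hj => .polynomial_eval (natDegree_indicatorPoly_lt hj)
    (.sum S (S.card_le_univ.trans_eq (Fintype.card_fin n)) fun v _ => .inp B (adjIdx w v))⟩
  apply_rules [PolyBounded.const, PolyBounded.id, PolyBounded.add, PolyBounded.mul]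

theorem exists_circuitComputable_neighborFeature :
    ∃ s : ℕ → ℕ, PolyBounded s ∧ ∀ {n l j : ℕ} (B : Set (ℝ → ℝ)) (w : Fin n),
      j < n → CircuitComputable B (s n) 16 fun x (_ : Fin l → ℝ) => neighborFeature x w j := by
  obtain ⟨s, hs, hindicator⟩ := exists_circuitComputable_indicatorPoly_neighborCount
  refine ⟨_, ?_, fun {n l j} B w hj => .sum Finset.univ (Finset.card_fin n).le fun u _ =>
    .mul (s := 2 * s n + 3) ((CircuitComputable.inp B _).mono subset_rfl (by omega) (by omega))
      (.mul (hindicator B w (Finset.Iio u) hj)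
        ((CircuitComputable.inp B _).mono subset_rfl (by omega) (by omega)))⟩
  apply_rules [PolyBounded.const, PolyBounded.id, PolyBounded.add, PolyBounded.mul]

theorem exists_circuitComputable_aggregate {i : ℕ} {B : Set (ℝ → ℝ)} {f : List ℝ → ℝ}
    (hf : (fun v => [f v]) ∈ FAC i B) :
    ∃ s d : ℕ → ℕ, PolyBounded s ∧ PolylogBounded i d ∧ ∀ {n l : ℕ} (w : Fin n),
      CircuitComputable B (s n) (d n) fun x (_ : Fin l → ℝ) => aggregate x w f := by
  obtain ⟨s, d, hs, hd, hf⟩ := exists_circuitComputable_of_mem_FAC hf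
  obtain ⟨s', hs', hindicator⟩ := exists_circuitComputable_indicatorPoly_neighborCount
  obtain ⟨s'', hs'', hfeature⟩ := exists_circuitComputable_neighborFeature
  have happly {n l : ℕ} (w t : Fin n) :
      CircuitComputable B (n * s'' n + (n + s n)) (16 + d n) fun x (_ : Fin l → ℝ) =>
        f (x (featIdx w) :: List.ofFn fun j : Fin t => neighborFeature x w j) := by
    have hargs (j : Fin (t + 1)) : CircuitComputable B (s'' n) 16 fun x (_ : Fin l → ℝ) =>
        (Fin.cons (x (featIdx w)) fun j : Fin t => neighborFeature x w j : Fin (t + 1) → ℝ) j := by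
      cases j using Fin.cases with
      | zero => exact (CircuitComputable.inp B (featIdx w)).mono subset_rfl (by omega) (by omega)
      | succ j => exact hfeature B w (j.2.trans t.2)
    have hsize : (t + 1) * s'' n + (t + 1 + s n) ≤ n * s'' n + (n + s n) := by
      gcongr <;> exact t.2
    simpa only [List.ofFn_cons] using ((hf t.2).comp hargs).mono subset_rfl hsize le_rfl
  refine ⟨_, _, ?_, ?_, fun {n l} w => .sum Finset.univ (Finset.card_fin n).le fun t _ =>
    .mul (s := s' n + (n * s'' n + (n + s n))) (d := 16 + d n)
      ((hindicator B w Finset.univ t.2).mono subset_rfl (by omega) (by omega))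
      ((happly w t).mono subset_rfl (by omega) le_rfl)⟩
  · apply_rules [PolyBounded.const, PolyBounded.id, PolyBounded.add, PolyBounded.mul]
  · apply_rules [PolylogBounded.const, PolylogBounded.add]

theorem exists_circuitComputable_layer {i p : ℕ} {B A : Set (ℝ → ℝ)} {f : Fin p → List ℝ → ℝ}
    {σ : Fin p → ℝ → ℝ} (hf : ∀ r, (fun v => [f r v]) ∈ FAC i B) (hσ : ∀ r, σ r ∈ A) :
    ∃ s d : ℕ → ℕ, PolyBounded s ∧ PolylogBounded i d ∧ ∀ {n : ℕ} (w : Fin n),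
      CircuitComputable (B ∪ A) (s n) (d n) fun x a => layer x w f σ a := by
  choose s d hs hd hagg using fun r => exists_circuitComputable_aggregate (hf r)
  have hact {n : ℕ} (w : Fin n) (r : Fin p) : CircuitComputable (B ∪ A) ((∑ r, s r n) + 2)
      ((∑ r, d r n) + 2) fun x (_ : Fin p → ℝ) => σ r (aggregate x w (f r)) :=
    .fn (.inr (hσ r)) <| (hagg r w).mono Set.subset_union_left
      (Finset.single_le_sum (f := fun r => s r n) (fun _ _ => Nat.zero_le _) (Finset.mem_univ r))
      (Finset.single_le_sum (f := fun r => d r n) (fun _ _ => Nat.zero_le _) (Finset.mem_univ r))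
  refine ⟨_, _, ?_, ?_, fun {n} w => .sum Finset.univ (Finset.card_fin p).le fun r _ =>
    .mul ((CircuitComputable.aux _ r).mono subset_rfl (Nat.zero_le _) (by omega)) (hact w r)⟩
  · apply_rules [PolyBounded.const, PolyBounded.add, PolyBounded.mul]
    exact .finsetSum _ fun r _ => hs r
  · apply_rules [PolylogBounded.const, PolylogBounded.add]
    exact .finsetSum _ fun r _ => hd r

end LayerCircuits

/-! ## Simulation by recurrent circuits -/

namespace RecCircuit

theorem state_succ {n : ℕ} (R : RecCircuit n) (x : Fin n → ℝ) (k : ℕ) :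
    R.state x (k + 1) = R.step (R.state x k) :=
  Function.iterate_succ_apply' _ _ _

section OfUpdate

variable {n l p : ℕ} (C : Fin n → ExtCircuit n l 1) (init : Fin l → ℝ) (ρ : Fin l → Fin l)
  (ι : Fin p ↪ Fin n) (halt : ℕ+ → List ℝ → Bool)

/-- The recurrent circuit that in each iteration replaces the `j`-th input by the output of `C j`
and rearranges the auxiliary memory by `ρ`. The new inputs are also its output, and those selected
by `ι` are passed to the halting function. -/
def ofUpdate : RecCircuit n where
  numAux := l
  numOut := n
  circuit := .comp (.select Sum.inl) C
  init := init
  recInp := ExtCircuit.wire _ C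
  recAux r := .aux (ρ r)
  recInp_ne_out := nofun
  recAux_ne_out := nofun
  numHalt := p
  haltGate := ι.trans ⟨ExtCircuit.wire _ C, ExtCircuit.wire_injective _ C⟩
  halt k v := halt k (List.ofFn v)

variable {C}

theorem ofUpdate_usesOnly {B : Set (ℝ → ℝ)} (hC : ∀ j, (C j).UsesOnly B) :
    (ofUpdate C init ρ ι halt).circuit.UsesOnly B :=
  ExtCircuit.UsesOnly.comp (D := .select Sum.inl) nofun hC

theorem ofUpdate_size_le {s : ℕ} (hs : ∀ j, Fintype.card (C j).Inner ≤ s) :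
    (ofUpdate C init ρ ι halt).circuit.size ≤ n + l + (n + (n * s + n)) := by
  refine (ExtCircuit.size_eq _).trans_le ?_
  refine Nat.add_le_add_left (Nat.add_le_add_left ?_ n) (n + l)
  exact ExtCircuit.comp_card_inner_le (D := .select Sum.inl) hs

theorem ofUpdate_depth_le {d : ℕ} (hd : ∀ j, (C j).depth ≤ d) :
    (ofUpdate C init ρ ι halt).circuit.depth ≤ d + 2 :=
  (ExtCircuit.comp_depth_le hd).trans (Nat.add_le_add_left (ExtCircuit.select_depth_le _) d)

variable (C) (x : Fin n → ℝ) (k : ℕ)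

theorem ofUpdate_step (s : (Fin n → ℝ) × (Fin l → ℝ)) :
    (ofUpdate C init ρ ι halt).step s = (fun j => (C j).eval s.1 s.2 0, s.2 ∘ ρ) :=
  Prod.ext (funext fun j => ExtCircuit.comp_val_wire _ C s.1 s.2 j)
    (funext fun r => ExtCircuit.val_aux _ s.1 s.2 (ρ r))

theorem ofUpdate_haltsAt_iff : (ofUpdate C init ρ ι halt).HaltsAt x k ↔
    halt k.succPNat (List.ofFn fun i => ((ofUpdate C init ρ ι halt).state x (k + 1)).1 (ι i)) := by
  rw [state_succ]
  rfl

theorem ofUpdate_circuit_eval_state :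
    (ofUpdate C init ρ ι halt).circuit.eval ((ofUpdate C init ρ ι halt).state x k).1
      ((ofUpdate C init ρ ι halt).state x k).2 =
      ((ofUpdate C init ρ ι halt).state x (k + 1)).1 := by
  have hstate := (state_succ (ofUpdate C init ρ ι halt) x k).trans (ofUpdate_step C init ρ ι halt _)
  refine Eq.trans (funext fun j => ?_) (congrArg Prod.fst hstate).symm
  exact (congrFun (ExtCircuit.comp_eval _ C _ _) j).trans (ExtCircuit.select_eval Sum.inl _ _ j)

end OfUpdate

end RecCircuit

section Simulation

variable {n p : ℕ}

/-- The encoding with the adjacency matrix kept and the feature values updated by a layer. -/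
noncomputable def graphUpdate (f : Fin p → List ℝ → ℝ) (σ : Fin p → ℝ → ℝ)
    (x : Fin (n * n + n) → ℝ) (a : Fin p → ℝ) : Fin (n * n + n) → ℝ :=
  Fin.append (fun q => x (Fin.castAdd n q)) fun w => layer x w f σ a

theorem graphUpdate_encodeVec (G : LabelledGraph) (h : Fin G.numV → ℝ) (f : Fin p → List ℝ → ℝ)
    (σ : Fin p → ℝ → ℝ) (r : Fin p) :
    graphUpdate f σ (G.encodeVec h) (Pi.single r 1) =
      G.encodeVec fun w => σ r (f r (h w :: (G.nbrs w).map h)) := by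
  simp only [graphUpdate, LabelledGraph.layer_encodeVec_single]
  simp only [LabelledGraph.encodeVec, Fin.append_left]

theorem circuitComputable_graphUpdate {B : Set (ℝ → ℝ)} {s d : ℕ} {f : Fin p → List ℝ → ℝ}
    {σ : Fin p → ℝ → ℝ} (hlayer : ∀ w : Fin n, CircuitComputable B s d fun x a => layer x w f σ a)
    (j : Fin (n * n + n)) :
    CircuitComputable B s (d + 2) fun x a => graphUpdate f σ x a j := by
  cases j using Fin.addCases with
  | left q =>
    simpa only [graphUpdate, Fin.append_left] using
      (CircuitComputable.inp B _).mono subset_rfl (Nat.zero_le s) (Nat.le_add_left 2 d)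
  | right w =>
    simpa only [graphUpdate, Fin.append_right] using
      (hlayer w).mono subset_rfl le_rfl (Nat.le_add_right d 2)

/-- `R` computes the function of `N` on all graphs whose encodings have length `n`. -/
def RecCircuit.Simulates (R : RecCircuit n) (N : RecCGNN) : Prop :=
  ∀ (G : LabelledGraph) (x : Fin n → ℝ), G.encode = List.ofFn x →
    (R.eval x).map List.ofFn = (N.eval G).map LabelledGraph.encode

theorem LabelledGraph.length_encode (G : LabelledGraph) :
    G.encode.length = G.numV * G.numV + G.numV := by
  rw [show G.encode = _ from G.encode_eq_ofFn G.feature, List.length_ofFn]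

variable [NeZero p] {N : RecCGNN}

theorem RecCGNN.layer_mod (hN : Function.Periodic (fun k => (N.fn k, N.act k)) p) (k : ℕ) :
    N.fn (Fin.ofNat p k + 1) = N.fn (k + 1) ∧ N.act (Fin.ofNat p k + 1) = N.act (k + 1) := by
  have hmod : (N.fn (k % p + 1), N.act (k % p + 1)) = (N.fn (k + 1), N.act (k + 1)) :=
    (hN.add_const 1).map_mod_nat k
  exact Prod.mk.inj hmod

variable (N p) in
/-- The recurrent circuit that keeps the encoding of a graph in its input gates and the current
layer, modulo `p`, as a one-hot vector in its auxiliary memory. -/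
noncomputable abbrev RecCGNN.recCircuit (C : Fin (n * n + n) → ExtCircuit (n * n + n) p 1) :
    RecCircuit (n * n + n) :=
  .ofUpdate C (Pi.single 0 1) (fun r => r - 1) (Fin.natAddEmb (n * n)) N.halt

theorem RecCGNN.recCircuit_state (hN : Function.Periodic (fun k => (N.fn k, N.act k)) p)
    (G : LabelledGraph)
    {C : Fin (G.numV * G.numV + G.numV) → ExtCircuit (G.numV * G.numV + G.numV) p 1}
    (hC : ∀ j x a, (C j).eval x a 0 =
      graphUpdate (fun r : Fin p => N.fn (r + 1)) (fun r => N.act (r + 1)) x a j) (k : ℕ) :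
    (N.recCircuit p C).state (G.encodeVec G.feature) k =
      (G.encodeVec (N.feat G k), Pi.single (Fin.ofNat p k) 1) := by
  induction k with
  | zero => rfl
  | succ k ih =>
    obtain ⟨hfn, hact⟩ := RecCGNN.layer_mod hN k
    rw [RecCircuit.state_succ, ih, RecCircuit.ofUpdate_step]
    have hsucc : Fin.ofNat p (k + 1) = Fin.ofNat p k + 1 := Fin.ext (Nat.add_mod k 1 p)
    refine Prod.ext ?_ ?_
    · simp only [hC, graphUpdate_encodeVec, hfn, hact]
      rfl
    · funext r
      simp only [hsucc, Function.comp_apply, Pi.single_apply, sub_eq_iff_eq_add]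

theorem RecCGNN.recCircuit_haltsAt_iff
    (hN : Function.Periodic (fun k => (N.fn k, N.act k)) p) (G : LabelledGraph)
    {C : Fin (G.numV * G.numV + G.numV) → ExtCircuit (G.numV * G.numV + G.numV) p 1}
    (hC : ∀ j x a, (C j).eval x a 0 =
      graphUpdate (fun r : Fin p => N.fn (r + 1)) (fun r => N.act (r + 1)) x a j) (k : ℕ) :
    (N.recCircuit p C).HaltsAt (G.encodeVec G.feature) k ↔ N.HaltsAt G k := by
  rw [RecCircuit.ofUpdate_haltsAt_iff, RecCGNN.recCircuit_state hN G hC]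
  simp only [LabelledGraph.encodeVec, Fin.natAddEmb_apply, Fin.append_right, RecCGNN.HaltsAt]

theorem RecCGNN.recCircuit_eval
    (hN : Function.Periodic (fun k => (N.fn k, N.act k)) p) (G : LabelledGraph)
    {C : Fin (G.numV * G.numV + G.numV) → ExtCircuit (G.numV * G.numV + G.numV) p 1}
    (hC : ∀ j x a, (C j).eval x a 0 =
      graphUpdate (fun r : Fin p => N.fn (r + 1)) (fun r => N.act (r + 1)) x a j) :
    ((N.recCircuit p C).eval (G.encodeVec G.feature)).map List.ofFn =
      (N.eval G).map LabelledGraph.encode := by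
  classical
  have hiff := RecCGNN.recCircuit_haltsAt_iff hN G hC
  refine Part.ext' (exists_congr hiff)
    fun (hR : ∃ k, (N.recCircuit p C).HaltsAt (G.encodeVec G.feature) k)
      (hG : ∃ k, N.HaltsAt G k) => ?_
  change List.ofFn ((N.recCircuit p C).circuit.eval
      ((N.recCircuit p C).state (G.encodeVec G.feature) (Nat.find hR)).1
      ((N.recCircuit p C).state (G.encodeVec G.feature) (Nat.find hR)).2) =
    LabelledGraph.encode { G with feature := N.feat G (Nat.find hG + 1) }
  rw [G.encode_eq_ofFn, ← Nat.find_congr' (hp := hR) (hq := hG) (hiff _)]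
  refine congrArg List.ofFn ((RecCircuit.ofUpdate_circuit_eval_state _ _ _ _ _ _ _).trans ?_)
  rw [RecCGNN.recCircuit_state hN G hC]

theorem RecCGNN.recCircuit_simulates {n : ℕ}
    (hN : Function.Periodic (fun k => (N.fn k, N.act k)) p)
    {C : Fin (n * n + n) → ExtCircuit (n * n + n) p 1}
    (hC : ∀ j x a, (C j).eval x a 0 =
      graphUpdate (fun r : Fin p => N.fn (r + 1)) (fun r => N.act (r + 1)) x a j) :
    (N.recCircuit p C).Simulates N := by
  intro G x hx
  have hlen : G.numV * G.numV + G.numV = n * n + n := by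
    rw [← G.length_encode, hx, List.length_ofFn]
  obtain rfl : G.numV = n := by nlinarith
  obtain rfl : G.encodeVec G.feature = x :=
    List.ofFn_injective ((G.encode_eq_ofFn G.feature).symm.trans hx)
  exact RecCGNN.recCircuit_eval hN G hC

end Simulation

theorem RecCGNN.exists_recCircuit_simulates {p M s d : ℕ} [NeZero p] {N : RecCGNN}
    (hN : Function.Periodic (fun k => (N.fn k, N.act k)) p) {B : Set (ℝ → ℝ)}
    (hlayer : ∀ n, n * n + n = M → ∀ w : Fin n, CircuitComputable B s d fun x a =>
      layer x w (fun r : Fin p => N.fn (r + 1)) (fun r => N.act (r + 1)) a) :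
    ∃ R : RecCircuit M, R.circuit.UsesOnly B ∧ R.circuit.size ≤ M + p + (M + (M * s + M)) ∧
      R.circuit.depth ≤ d + 2 + 2 ∧ (∀ k v, R.halt k v = N.halt k (List.ofFn v)) ∧
      R.Simulates N := by
  by_cases hM : ∃ n, n * n + n = M
  · obtain ⟨n, rfl⟩ := hM
    choose C hB hs hd hC using circuitComputable_graphUpdate (hlayer n rfl)
    exact ⟨N.recCircuit p C, RecCircuit.ofUpdate_usesOnly _ _ _ _ hB,
      RecCircuit.ofUpdate_size_le _ _ _ _ hs, RecCircuit.ofUpdate_depth_le _ _ _ _ hd,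
      fun _ _ => rfl, RecCGNN.recCircuit_simulates hN hC⟩
  · choose C hB hs hd _ using fun j : Fin M => (CircuitComputable.inp (l := p) B j).mono subset_rfl
      (Nat.zero_le s) (Nat.le_add_left 2 d)
    refine ⟨.ofUpdate C 0 id (Fin.castLEEmb M.zero_le) N.halt,
      RecCircuit.ofUpdate_usesOnly _ _ _ _ hB, RecCircuit.ofUpdate_size_le _ _ _ _ hs,
      RecCircuit.ofUpdate_depth_le _ _ _ _ hd, fun _ _ => rfl, fun G x hx => ?_⟩
    exact absurd ⟨G.numV, by rw [← G.length_encode, hx, List.length_ofFn]⟩ hM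

theorem mainTheorem1_general (i j : ℕ) (B B' A : Set (ℝ → ℝ)) (N : RecCGNN)
    (hN : N.IsGNN {h | ∃ D : CircuitFamily, D.IsFAC j B' ∧ ∀ (k : ℕ+) (v : List ℝ),
      D.eval (((k : ℕ) : ℝ) :: v) = [bitR (h k v)]} {f | (fun x => [f x]) ∈ FAC i B} A) :
    ∃ fcirc ∈ RecFAC j B' i (B ∪ A), ∀ G : LabelledGraph,
      fcirc G.encode = (N.eval G).map LabelledGraph.encode := by
  obtain ⟨p, hp, hperiodic⟩ := hN.periodic
  have : NeZero p := ⟨hp.ne'⟩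
  obtain ⟨s, d, hs, hd, hlayer⟩ := exists_circuitComputable_layer
    (fun r : Fin p => hN.fn_mem (r + 1)) fun r => hN.act_mem (r + 1)
  have hsqrt (n : ℕ) : (n * n + n).sqrt = n := Nat.sqrt_add_eq n (Nat.le_add_left n n)
  choose R hRB hRs hRd hRhalt hRsim using fun M =>
    N.exists_recCircuit_simulates (M := M) (s := s M.sqrt) (d := d M.sqrt) hperiodic
      fun n hn w => by rw [← hn, hsqrt]; exact hlayer w
  obtain ⟨D, hD, hDhalt⟩ := hN.halt_mem
  refine ⟨RecCircuitFamily.eval R, ⟨R, ⟨hRB, .mono ?_ hRs, .mono ?_ hRd⟩, ⟨D, hD, ?_⟩, rfl⟩, ?_⟩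
  · apply_rules [PolyBounded.const, PolyBounded.id, PolyBounded.add, PolyBounded.mul,
      PolyBounded.comp_sqrt]
  · apply_rules [PolylogBounded.const, PolylogBounded.add, PolylogBounded.comp_sqrt]
  · exact fun n k v => by rw [hDhalt, hRhalt]
  · exact fun G => hRsim _ G G.encode.get (List.ofFn_get _).symm

theorem mainTheorem1 (i : ℕ) (B A : Set (ℝ → ℝ)) (N : RecCGNN)
    (hN : N.IsGNN (tFACHalt i (B ∪ {signFn})) (tFAC i B) A) :
    ∃ fcirc ∈ RecFAC i (B ∪ {signFn}) i (B ∪ A), ∀ G : LabelledGraph,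
      fcirc G.encode = (N.eval G).map LabelledGraph.encode :=
  mainTheorem1_general i i B (B ∪ {signFn}) A N
    ⟨hN.periodic, fun k => (hN.fn_mem k).2, hN.act_mem, hN.halt_mem.2⟩
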